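/- Let $K\subset\mathbb C$ be a compact, connected and simply connected set, let $\Omega$ be the unbounded component of $\mathbb C\setminus K$, and suppose that $\Gamma=\partial\Omega$ is a real analytic curve, i.e. a simple closed curve $\Gamma=\gamma(\mathbb R)$ with $\gamma:\mathbb R\to\mathbb C$ real analytic, $2\pi$-periodic, injective on $[0,2\pi)$ and $\gamma'(t)\neq0$ for all $t$. Let $\Phi$ be a conformal map of $\Omega$ onto $\{w\in\mathbb C:|w|>1\}$. For a finite positive Borel measure $\nu$ on a compact subset of $\mathbb C$, $n\ge 0$ and $z\in\mathbb C$, let $$\lambda_n(\nu,z)=\inf\Big\{\int|p|^2\,d\nu:\ p\in\mathbb C[w],\ \deg p\le n,\ p(z)=1\Big\},\qquad \lambda_\infty(\nu,z)=\lim_{n\to\infty}\lambda_n(\nu,z),$$ and, for a finite positive Borel measure $\mu$ on $\Gamma$ and $z\in\Omega$, let $$\tilde\lambda_n(\mu,z)=|\Phi(z)|^{2n}\lambda_n(\mu,z),\qquad \tilde\lambda_\infty(\mu,z)=\liminf_{n\to\infty}\tilde\lambda_n(\mu,z).$$ Then $\Phi$ extends continuously to $\overline\Omega$ (the extension is again denoted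 $\Phi$), with $\Phi(\Gamma)\subset\mathbb T=\{w\in\mathbb C:|w|=1\}$, and for every finite positive Borel measure $\mu$ on $\Gamma$, with push-forward $\Phi_*\mu$ on $\mathbb T$, and every $z\in\Omega$, the limits $\lim_{n\to\infty}\tilde\lambda_n(\mu,z)$ and $\lim_{n\to\infty}\lambda_n\big(\Phi_*\mu,1/\overline{\Phi(z)}\big)$ exist in $\mathbb{R}$, the first being $\tilde\lambda_\infty(\mu,z)$, and $$\tilde\lambda_\infty(\mu,z)=\lambda_\infty\big(\Phi_*\mu,\,1/\overline{\Phi(z)}\big).$$ -/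

import Mathlib

open Set Filter Topology MeasureTheory

noncomputable section

/-- The unbounded component `Ω` of `ℂ ∖ K`: the points off `K` whose connected component in the
complement of `K` is unbounded. (For compact `K` there is exactly one unbounded component.) -/
def unboundedComponent (K : Set ℂ) : Set ℂ :=
  {z | z ∈ Kᶜ ∧ ¬ Bornology.IsBounded (connectedComponentIn Kᶜ z)}

/-- `Γ` is a (regular, simple, closed) real analytic curve in the plane: it is the trace of a
`2π`-periodic real analytic map with nowhere vanishing derivative, injective on a period. -/
def IsAnalyticClosedCurve (Γ : Set ℂ) : Prop :=
  ∃ γ : ℝ → ℂ, AnalyticOnNhd ℝ γ univ ∧ Function.Periodic γ (2 * Real.pi) ∧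
    (∀ t, deriv γ t ≠ 0) ∧ InjOn γ (Ico 0 (2 * Real.pi)) ∧ range γ = Γ

/-- `Φ` maps the open set `Ω` conformally (bijectively and holomorphically) onto the exterior
`{w : |w| > 1}` of the closed unit disk. The values of `Φ` off `Ω` play no role. -/
def IsExteriorConformalMap (Ω : Set ℂ) (Φ : ℂ → ℂ) : Prop :=
  DifferentiableOn ℂ Φ Ω ∧ BijOn Φ Ω {w : ℂ | 1 < ‖w‖}

/-- The Christoffel function `λ_n(ν, z)`: the infimum of `∫ |p|² dν` over complex polynomials `p`
of degree at most `n` with `p(z) = 1`. -/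
def christoffel (n : ℕ) (ν : Measure ℂ) (z : ℂ) : ℝ :=
  sInf {x : ℝ | ∃ p : Polynomial ℂ, p.natDegree ≤ n ∧ p.eval z = 1 ∧
    x = ∫ w, ‖p.eval w‖ ^ 2 ∂ν}

/-- `λ_∞(ν, z) = lim_n λ_n(ν, z)`. -/
def christoffelLimit (ν : Measure ℂ) (z : ℂ) : ℝ :=
  limUnder atTop fun n : ℕ => christoffel n ν z

/-- The normalized Christoffel function `λ̃_n(μ, z) = |Φ(z)|^{2n} λ_n(μ, z)`. -/
def normChristoffel (Φ : ℂ → ℂ) (n : ℕ) (μ : Measure ℂ) (z : ℂ) : ℝ :=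
  ‖Φ z‖ ^ (2 * n) * christoffel n μ z

/-- `λ̃_∞(μ, z) = liminf_n λ̃_n(μ, z)`. -/
def normChristoffelLimit (Φ : ℂ → ℂ) (μ : Measure ℂ) (z : ℂ) : ℝ :=
  liminf (fun n : ℕ => normChristoffel Φ n μ z) atTop

/-- The push-forward `Φ_* μ` of a measure `μ` carried by `∂Ω`; on `∂Ω` the map `Φ` is given by its
boundary values `lim_{ζ → x, ζ ∈ Ω} Φ(ζ)`. -/
def boundaryPushforward (Ω : Set ℂ) (Φ : ℂ → ℂ) (μ : Measure ℂ) : Measure ℂ :=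
  μ.map (extendFrom Ω Φ)

end

/-! Put `φ = 1/Φ`, a conformal map of `Ω` onto the punctured unit disc, and let `X` be its inverse.
Because the boundary curve is analytic and `Ω` lies on one side of it, Schwarz reflection extends
`φ` injectively across each boundary point. Hence `X` continues to `0 < ‖u‖ < ρ` for some `ρ > 1`,
where it has the form `h u / u` with `h` holomorphic on `‖u‖ < ρ` and `h 0 ≠ 0`, and it sends `1 <
‖u‖ < ρ` off the closure of `Ω` (`exists_continuedInverse`).

On the curve `‖φ‖ = 1`, so `Φ = conj φ` there. Conjugating coefficients therefore turns the extremal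
problem for the push-forward at `1 / conj (Φ z)` into that of minimising `∫ ‖q (φ x)‖² dμ` over
polynomials `q` with `q (φ z) = 1`; let `L` be its infimum over all degrees. The two sides are
compared by the correspondence `P ↦ u ^ n * P (X u)`, which preserves the modulus on the boundary.

Lower bound (`lower_bound`): if `deg P ≤ n` and `P z = 1`, then `u ^ n * P (X u)` is holomorphic
beyond the closed disc and equals `φ z ^ n` at `φ z`. It is a uniform limit of polynomials on the
closed disc, so `∫ ‖P‖² dμ ≥ L ‖φ z‖ ^ (2 n)`.

Upper bound (`upper_bound`): given `q`, one needs `P` of degree at most `n` with `u ^ n * P (X u)`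
close to `q u`. The Faber polynomial `F_k`, the polynomial in `X` carrying the polar part and
constant term of `u ^ (-k)`, satisfies `F_k (X u) = u ^ (-k) + O(r ^ (-k))` uniformly on the closed
disc, for some `r > 1` (`exists_faber`). Replacing each `u ^ j` of `q` by `F_(n-j)` gives `P`. -/

/-! ### Injective holomorphic functions -/

/-- A holomorphic function that is injective near a point has open germ there. -/
theorem Set.InjOn.nhds_le_map_nhds {f : ℂ → ℂ} {U : Set ℂ} (hf : AnalyticOnNhd ℂ f U)
    (hinj : InjOn f U) (hU : IsOpen U) {a : ℂ} (ha : a ∈ U) : 𝓝 (f a) ≤ map f (𝓝 a) := by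
  refine (hf a ha).eventually_constant_or_nhds_le_map_nhds.resolve_left fun h => ?_
  have h1 : ∀ᶠ z in 𝓝[≠] a, False := by
    filter_upwards [nhdsWithin_le_nhds h, nhdsWithin_le_nhds (hU.mem_nhds ha),
      self_mem_nhdsWithin] with z hz hzU hza
    exact hza (hinj hzU ha hz)
  exact h1.exists.choose_spec

theorem Set.InjOn.isOpen_image_of_analyticOnNhd {f : ℂ → ℂ} {U : Set ℂ}
    (hf : AnalyticOnNhd ℂ f U) (hinj : InjOn f U) (hU : IsOpen U) {V : Set ℂ} (hVU : V ⊆ U)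
    (hV : IsOpen V) : IsOpen (f '' V) := by
  rw [isOpen_iff_mem_nhds]
  rintro _ ⟨z, hz, rfl⟩
  exact Set.InjOn.nhds_le_map_nhds hf hinj hU (hVU hz) (image_mem_map (hV.mem_nhds hz))

/-- The derivative of an injective holomorphic function does not vanish. -/
theorem Set.InjOn.deriv_ne_zero_of_analyticOnNhd {f : ℂ → ℂ} {U : Set ℂ}
    (hf : AnalyticOnNhd ℂ f U) (hinj : InjOn f U) (hU : IsOpen U) {a : ℂ} (ha : a ∈ U) :
    deriv f a ≠ 0 := by
  -- The inverse `g` is continuous since `f` is open, and holomorphic wherever `deriv f ≠ 0`. Zeros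
  -- of `deriv f` are isolated, so `f a` is a removable singularity of `g`; the chain rule for `g ∘
  -- f = id` then forbids `deriv f a = 0`.
  set g := Function.invFunOn f U with hg
  have hgf : ∀ z ∈ U, g (f z) = z := fun z hz => hinj.leftInvOn_invFunOn hz
  have hcont : ∀ z ∈ U, ContinuousAt g (f z) := by
    intro z hz
    rw [ContinuousAt, hgf z hz]
    refine Tendsto.mono_left ?_ (Set.InjOn.nhds_le_map_nhds hf hinj hU hz)
    rw [tendsto_map'_iff]
    refine tendsto_id.congr' ?_
    filter_upwards [hU.mem_nhds hz] with w hw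
    simp [hgf w hw]
  have hd : ∀ z ∈ U, deriv f z ≠ 0 → DifferentiableAt ℂ g (f z) := by
    intro z hz h0
    exact ((hf z hz).hasStrictDerivAt.to_local_left_inverse h0
      (by filter_upwards [hU.mem_nhds hz] with w hw using hgf w hw)).hasDerivAt.differentiableAt
  have hnc : ∀ᶠ z in 𝓝[≠] a, deriv f z ≠ 0 := by
    refine ((hf a ha).deriv.eventually_eq_zero_or_eventually_ne_zero).resolve_left fun h => ?_
    obtain ⟨r, hr, hball⟩ := Metric.eventually_nhds_iff_ball.1
      (h.and (hU.mem_nhds ha))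
    have hconst : ∀ z ∈ Metric.ball a r, f z = f a := by
      intro z hz
      refine (Metric.isOpen_ball (x := a) (ε := r)).is_const_of_deriv_eq_zero
        (convex_ball a r).isPreconnected
        (fun w hw => ((hf w (hball w hw).2).differentiableAt).differentiableWithinAt)
        (fun w hw => (hball w hw).1) hz (Metric.mem_ball_self hr)
    have h1 : ∀ᶠ z in 𝓝[≠] a, False := by
      filter_upwards [nhdsWithin_le_nhds (Metric.ball_mem_nhds a hr), self_mem_nhdsWithin]
        with z hz hza
      exact hza (hinj (hball z hz).2 ha (hconst z hz))
    exact h1.exists.choose_spec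
  have hdg : DifferentiableAt ℂ g (f a) := by
    refine (Complex.analyticAt_of_differentiable_on_punctured_nhds_of_continuousAt ?_
      (hcont a ha)).differentiableAt
    rw [eventually_nhdsWithin_iff] at hnc ⊢
    have := Set.InjOn.nhds_le_map_nhds hf hinj hU ha
    refine this ?_
    change ∀ᶠ z in 𝓝 a, (f z ∈ ({f a}ᶜ : Set ℂ) → DifferentiableAt ℂ g (f z))
    filter_upwards [hnc, hU.mem_nhds ha] with z hz hzU hne
    exact hd z hzU (hz (fun h => hne (by rw [mem_singleton_iff.1 h]; rfl)))
  intro h0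
  have h1 : HasDerivAt (g ∘ f) (deriv g (f a) * deriv f a) a :=
    hdg.hasDerivAt.comp a (hf a ha).differentiableAt.hasDerivAt
  have h2 : HasDerivAt (g ∘ f) 1 a := (hasDerivAt_id a).congr_of_eventuallyEq
    (by filter_upwards [hU.mem_nhds ha] with w hw using hgf w hw)
  have := h1.unique h2
  simp [h0] at this

theorem Set.InjOn.differentiableAt_leftInverse {f g : ℂ → ℂ} {U : Set ℂ}
    (hf : AnalyticOnNhd ℂ f U) (hinj : InjOn f U) (hU : IsOpen U) (hgf : ∀ z ∈ U, g (f z) = z)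
    {a : ℂ} (ha : a ∈ U) : DifferentiableAt ℂ g (f a) :=
  ((hf a ha).hasStrictDerivAt.to_local_left_inverse
    (Set.InjOn.deriv_ne_zero_of_analyticOnNhd hf hinj hU ha)
    (by filter_upwards [hU.mem_nhds ha] with w hw using hgf w hw)).hasDerivAt.differentiableAt

/-! ### Continuation and reflection across a line segment -/

/-- A real analytic curve is locally the restriction of a holomorphic function. -/
theorem AnalyticAt.exists_complex_extension {γ : ℝ → ℂ} {t : ℝ} (hγ : AnalyticAt ℝ γ t) :
    ∃ g : ℂ → ℂ, AnalyticAt ℂ g t ∧ ∀ᶠ s : ℝ in 𝓝 t, g s = γ s := by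
  obtain ⟨p, r, hp⟩ := hγ
  -- The Taylor series of `γ` read with a complex variable: same coefficients, hence same norms and
  -- same radius.
  set q : FormalMultilinearSeries ℂ ℂ ℂ := FormalMultilinearSeries.ofScalars ℂ p.coeff with hq
  have hrad : q.radius = p.radius := by
    have : ∀ n, ‖q n‖ = ‖p n‖ := fun n => by simp [hq]
    simp only [FormalMultilinearSeries.radius, this]
  have hqpos : 0 < q.radius := by rw [hrad]; exact hp.r_pos.trans_le hp.r_le
  have hqf := q.hasFPowerSeriesOnBall hqpos
  refine ⟨fun z => q.sum (z - t), ?_, ?_⟩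
  · have := hqf.comp_sub (t : ℂ)
    simp only [zero_add] at this
    exact this.analyticAt
  · have hb : Metric.eball (t : ℝ) r ∈ 𝓝 t := Metric.eball_mem_nhds t hp.r_pos
    filter_upwards [hb] with s hs
    have h1 := hp.hasSum_sub hs
    rw [← h1.tsum_eq]
    simp only [FormalMultilinearSeries.sum]
    congr 1; ext n
    simp [hq]

/-- **Painlevé's theorem** for a segment: a continuous function on a disc centred on the real line
which is holomorphic off the real line is holomorphic. -/
theorem ContinuousOn.differentiableOn_ball_of_off_real {T : ℂ → ℂ} {ε : ℝ}
    (hc : ContinuousOn T (Metric.ball 0 ε))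
    (hd : ∀ s ∈ Metric.ball (0 : ℂ) ε, s.im ≠ 0 → DifferentiableAt ℂ T s) :
    DifferentiableOn ℂ T (Metric.ball 0 ε) := by
  refine ((Complex.isConservativeOn_and_continuousOn_iff_isDifferentiableOn
    Metric.isOpen_ball).1 ⟨?_, hc⟩)
  intro z w hzw
  rw [← add_eq_zero_iff_eq_neg, Complex.wedgeIntegral_add_wedgeIntegral_eq]
  -- Cauchy's theorem for rectangles whose open interior misses the real axis; continuity up to the
  -- edges suffices. A rectangle that crosses the axis is cut along it into two of these.
  have key : ∀ a b : ℝ, uIcc a b ⊆ uIcc z.im w.im → (0 : ℝ) ∉ Ioo (min a b) (max a b) →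
      ((∫ x : ℝ in z.re..w.re, T (x + a * Complex.I)) -
        ∫ x : ℝ in z.re..w.re, T (x + b * Complex.I)) +
      Complex.I • (∫ y : ℝ in a..b, T (w.re + y * Complex.I)) -
      Complex.I • (∫ y : ℝ in a..b, T (z.re + y * Complex.I)) = 0 := by
    intro a b hab h0
    have hsub : uIcc z.re w.re ×ℂ uIcc a b ⊆ Metric.ball 0 ε := fun s hs =>
      hzw ⟨hs.1, hab hs.2⟩
    have := Complex.integral_boundary_rect_eq_zero_of_continuousOn_of_differentiableOn T
      (z.re + a * Complex.I) (w.re + b * Complex.I) (by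
        simpa using hc.mono hsub) (by
        intro s hs
        simp only [Complex.add_re, Complex.ofReal_re, Complex.mul_re, Complex.I_re, mul_zero,
          Complex.ofReal_im, Complex.I_im, mul_one, sub_self, add_zero, Complex.add_im,
          Complex.mul_im, zero_add] at hs
        refine (hd s (hsub ⟨Ioo_subset_Icc_self hs.1, Ioo_subset_Icc_self hs.2⟩)
          fun h => h0 ?_).differentiableWithinAt
        rw [← h]; exact hs.2)
    simpa using this
  by_cases h0 : (0 : ℝ) ∈ Ioo (min z.im w.im) (max z.im w.im)
  · have h0' : (0 : ℝ) ∈ uIcc z.im w.im := Ioo_subset_Icc_self h0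
    have h1 := key z.im 0 (uIcc_subset_uIcc left_mem_uIcc h0') (by
      rintro ⟨h, h'⟩
      rcases le_total z.im 0 with h2 | h2 <;> simp [h2] at h h')
    have h2 := key 0 w.im (uIcc_subset_uIcc h0' right_mem_uIcc) (by
      rintro ⟨h, h'⟩
      rcases le_total w.im 0 with h2 | h2 <;> simp [h2] at h h')
    have hint : ∀ c ∈ uIcc z.re w.re, ∀ a b : ℝ, uIcc a b ⊆ uIcc z.im w.im →
        IntervalIntegrable (fun y : ℝ => T (c + y * Complex.I)) volume a b := by
      intro c hcm a b hab
      refine (hc.comp (by fun_prop) ?_).intervalIntegrable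
      intro y hy
      exact hzw ⟨by simpa using hcm, by simpa using hab hy⟩
    have hz0 := uIcc_subset_uIcc left_mem_uIcc h0'
    have h0w := uIcc_subset_uIcc h0' right_mem_uIcc
    rw [← intervalIntegral.integral_add_adjacent_intervals
        (hint w.re right_mem_uIcc z.im 0 hz0) (hint w.re right_mem_uIcc 0 w.im h0w),
      ← intervalIntegral.integral_add_adjacent_intervals
        (hint z.re left_mem_uIcc z.im 0 hz0) (hint z.re left_mem_uIcc 0 w.im h0w)]
    simp only [smul_eq_mul] at h1 h2 ⊢
    linear_combination h1 + h2
  · exact key z.im w.im Subset.rfl h0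

/-- Two bounded holomorphic functions on the upper and lower half of a disc whose jump across the
diameter vanishes are restrictions of one holomorphic function. -/
theorem exists_differentiableOn_ball_of_jump_zero {g₁ g₂ : ℂ → ℂ} {ε : ℝ} {C : NNReal} (hε : 0 < ε)
    (h₁ : DifferentiableOn ℂ g₁ (Metric.ball 0 ε ∩ {s | 0 < s.im}))
    (h₂ : DifferentiableOn ℂ g₂ (Metric.ball 0 ε ∩ {s | s.im < 0}))
    (hb₁ : ∀ s ∈ Metric.ball (0 : ℂ) ε ∩ {s | 0 < s.im}, ‖g₁ s‖ ≤ C)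
    (hb₂ : ∀ s ∈ Metric.ball (0 : ℂ) ε ∩ {s | s.im < 0}, ‖g₂ s‖ ≤ C)
    (hj : ∀ t : ℝ, |t| < ε → Tendsto (fun s => g₁ s - g₂ (starRingEnd ℂ s))
      (𝓝[{s | 0 < s.im}] (t : ℂ)) (𝓝 0)) :
    ∃ F : ℂ → ℂ, DifferentiableOn ℂ F (Metric.ball 0 ε) ∧
      (∀ s ∈ Metric.ball (0 : ℂ) ε, 0 < s.im → F s = g₁ s) ∧
      (∀ s ∈ Metric.ball (0 : ℂ) ε, s.im < 0 → F s = g₂ s) := by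
  have hup : IsOpen {s : ℂ | 0 < s.im} := isOpen_lt continuous_const Complex.continuous_im
  have hlo : IsOpen {s : ℂ | s.im < 0} := isOpen_lt Complex.continuous_im continuous_const
  have ho₁ := Metric.isOpen_ball.inter (s := Metric.ball (0 : ℂ) ε) hup
  have ho₂ := Metric.isOpen_ball.inter (s := Metric.ball (0 : ℂ) ε) hlo
  have hc₁ : Convex ℝ (Metric.ball (0 : ℂ) ε ∩ {s | 0 < s.im}) :=
    (convex_ball _ _).inter (convex_halfSpace_im_gt 0)
  have hc₂ : Convex ℝ (Metric.ball (0 : ℂ) ε ∩ {s | s.im < 0}) :=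
    (convex_ball _ _).inter (convex_halfSpace_im_lt 0)
  -- Neither `g₁` nor `g₂` need have boundary values, but their primitives do: bounded derivatives
  -- make them Lipschitz on the convex half discs, so they extend continuously to the plane.
  obtain ⟨A, hA⟩ := hc₁.exists_forall_hasDerivWithinAt h₁
  obtain ⟨B, hB⟩ := hc₂.exists_forall_hasDerivWithinAt h₂
  obtain ⟨A', hA'L, hA'⟩ := (hc₁.lipschitzOnWith_of_nnnorm_hasDerivWithin_le hA
    (C := C) (fun x hx => hb₁ x hx)).extend_finite_dimension
  obtain ⟨B', hB'L, hB'⟩ := (hc₂.lipschitzOnWith_of_nnnorm_hasDerivWithin_le hB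
    (C := C) (fun x hx => hb₂ x hx)).extend_finite_dimension
  have hdA : ∀ s ∈ Metric.ball (0 : ℂ) ε, 0 < s.im → HasDerivAt A' (g₁ s) s := by
    intro s hs hs'
    have hm := ho₁.mem_nhds ⟨hs, hs'⟩
    exact ((hA s ⟨hs, hs'⟩).hasDerivAt hm).congr_of_eventuallyEq
      (by filter_upwards [hm] with w hw using (hA' hw).symm)
  have hdB : ∀ s ∈ Metric.ball (0 : ℂ) ε, s.im < 0 → HasDerivAt B' (g₂ s) s := by
    intro s hs hs'
    have hm := ho₂.mem_nhds ⟨hs, hs'⟩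
    exact ((hB s ⟨hs, hs'⟩).hasDerivAt hm).congr_of_eventuallyEq
      (by filter_upwards [hm] with w hw using (hB' hw).symm)
  set J : ℝ → ℂ := fun x => A' x - B' x with hJ
  -- At heights `y` and `-y` the difference of the primitives has `x`-derivative equal to the jump,
  -- which is at most `η` near `t`. The mean value inequality survives the limit `y → 0`, so the
  -- difference `J` of boundary values has zero derivative.
  have hJd : ∀ t ∈ Ioo (-ε) ε, HasDerivAt J 0 t := by
    intro t ht
    rw [hasDerivAt_iff_isLittleO, Asymptotics.isLittleO_iff]
    intro η hη
    have h1 := Metric.tendsto_nhdsWithin_nhds.1 (hj t (abs_lt.2 ht)) η hη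
    obtain ⟨δ, hδ, h1⟩ := h1
    obtain ⟨δ', hδ', hball⟩ := Metric.mem_nhds_iff.1
      (Metric.isOpen_ball.mem_nhds (show (t : ℂ) ∈ Metric.ball (0 : ℂ) ε by
        simpa using abs_lt.2 ht))
    set r := min δ δ' / 2 with hr
    have hr0 : 0 < r := by positivity
    filter_upwards [Metric.ball_mem_nhds t hr0] with x hx
    have hmem : ∀ x' ∈ Metric.ball t r, ∀ y : ℝ, |y| < r →
        dist ((x' : ℂ) + y * Complex.I) t < min δ δ' := by
      intro x' hx' y hy
      have e : (x' : ℂ) + y * Complex.I - t = ((x' - t : ℝ) : ℂ) + (y : ℂ) * Complex.I := by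
        push_cast; ring
      rw [dist_eq_norm, e]
      have h3 := norm_add_le (((x' - t : ℝ) : ℂ)) ((y : ℂ) * Complex.I)
      rw [norm_mul, Complex.norm_I, mul_one, Complex.norm_real, Complex.norm_real] at h3
      have h4 : ‖x' - t‖ < r := by simpa [dist_eq_norm] using hx'
      have h5 : ‖y‖ < r := hy
      have : r + r = min δ δ' := by rw [hr]; ring
      linarith
    have key : ∀ y ∈ Ioo 0 r, ‖(A' (x + y * Complex.I) - B' (x - y * Complex.I)) -
        (A' (t + y * Complex.I) - B' (t - y * Complex.I))‖ ≤ η * ‖x - t‖ := by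
      intro y hy
      refine (convex_ball t r).norm_image_sub_le_of_norm_hasDerivWithin_le
        (f := fun x : ℝ => A' (x + y * Complex.I) - B' (x - y * Complex.I))
        (f' := fun x : ℝ => g₁ (x + y * Complex.I) - g₂ (x - y * Complex.I))
        (fun x' hx' => ?_) (fun x' hx' => ?_) (Metric.mem_ball_self hr0) hx
      · have m1 := hmem x' hx' y (by rw [abs_of_pos hy.1]; exact hy.2)
        have m2 := hmem x' hx' (-y) (by rw [abs_neg, abs_of_pos hy.1]; exact hy.2)
        have m1' := hball (Metric.mem_ball.2 (m1.trans_le (min_le_right _ _)))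
        have m2' := hball (Metric.mem_ball.2 (m2.trans_le (min_le_right _ _)))
        simp only [Complex.ofReal_neg, neg_mul, ← sub_eq_add_neg] at m2'
        have d1 := (hdA _ m1' (by simpa using hy.1)).comp_add_const (x' : ℂ) (y * Complex.I)
        have d2 := (hdB _ m2' (by simpa using hy.1)).comp_sub_const (x' : ℂ) (y * Complex.I)
        exact ((d1.sub d2).comp_ofReal).hasDerivWithinAt
      · have m1 := hmem x' hx' y (by rw [abs_of_pos hy.1]; exact hy.2)
        have := h1 (x := x' + y * Complex.I) (by simpa using hy.1)
          (m1.trans_le (min_le_left _ _))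
        rw [dist_zero_right] at this
        simpa [← sub_eq_add_neg] using this.le
    have hlim : Tendsto (fun y : ℝ => ‖(A' (x + y * Complex.I) - B' (x - y * Complex.I)) -
        (A' (t + y * Complex.I) - B' (t - y * Complex.I))‖) (𝓝[>] 0) (𝓝 ‖J x - J t‖) := by
      have hAc := hA'L.continuous
      have hBc := hB'L.continuous
      have : Continuous (fun y : ℝ => ‖(A' (x + y * Complex.I) - B' (x - y * Complex.I)) -
        (A' (t + y * Complex.I) - B' (t - y * Complex.I))‖) := by fun_prop
      have := (this.tendsto 0).mono_left (nhdsWithin_le_nhds (s := Ioi 0))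
      simpa [hJ] using this
    have := le_of_tendsto hlim (by
      filter_upwards [Ioo_mem_nhdsGT hr0] with y hy using key y hy)
    simpa using this
  have hJc : ∀ t ∈ Ioo (-ε) ε, J t = J 0 := by
    intro t ht
    refine isOpen_Ioo.is_const_of_deriv_eq_zero isPreconnected_Ioo
      (fun x hx => (hJd x hx).differentiableAt.differentiableWithinAt)
      (fun x hx => (hJd x hx).deriv) ht ⟨by linarith, hε⟩
  classical
  -- Since `J` is constant, the primitives glue continuously after a shift by `J 0`. Painlevé's
  -- theorem applies to the glued primitive, and its derivative is the required function.
  set T : ℂ → ℂ := fun s => if 0 ≤ s.im then A' s else B' s + J 0 with hT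
  have hTc : ContinuousOn T (Metric.ball 0 ε) := by
    refine ContinuousOn.if ?_ hA'L.continuous.continuousOn
      (hB'L.continuous.add continuous_const).continuousOn
    rintro a ⟨ha, ha'⟩
    have him : a.im = 0 := by
      rw [Complex.frontier_setOfPred_le_im] at ha'; exact ha'
    have hare : (a.re : ℂ) = a := by apply Complex.ext <;> simp [him]
    have h2 : a.re ∈ Ioo (-ε) ε := by
      refine abs_lt.1 ((Complex.abs_re_le_norm a).trans_lt (by simpa using ha))
    have := hJc _ h2
    rw [← this, hJ]
    simp only [hare]
    ring
  have hT1 : ∀ s ∈ Metric.ball (0 : ℂ) ε, 0 < s.im → HasDerivAt T (g₁ s) s := by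
    intro s hs hs'
    refine (hdA s hs hs').congr_of_eventuallyEq ?_
    filter_upwards [hup.mem_nhds hs'] with w hw
    simp [hT, le_of_lt (show 0 < w.im from hw)]
  have hT2 : ∀ s ∈ Metric.ball (0 : ℂ) ε, s.im < 0 → HasDerivAt T (g₂ s) s := by
    intro s hs hs'
    refine ((hdB s hs hs').add_const (J 0)).congr_of_eventuallyEq ?_
    filter_upwards [hlo.mem_nhds hs'] with w hw
    simp [hT, not_le.2 (show w.im < 0 from hw)]
  have hTd := hTc.differentiableOn_ball_of_off_real (fun s hs h0 => by
    rcases lt_or_gt_of_ne h0 with h | h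
    · exact (hT2 s hs h).differentiableAt
    · exact (hT1 s hs h).differentiableAt)
  exact ⟨deriv T, hTd.deriv Metric.isOpen_ball, fun s hs h => (hT1 s hs h).deriv,
    fun s hs h => (hT2 s hs h).deriv⟩

/-- **Schwarz reflection** in the unit circle, across a segment on which only the modulus of the
function is known to have boundary values. -/
theorem exists_reflection_extension {g : ℂ → ℂ} {ε : ℝ} (hε : 0 < ε)
    (hg : DifferentiableOn ℂ g (Metric.ball 0 ε ∩ {s | 0 < s.im}))
    (hlim : ∀ t : ℝ, |t| < ε →
      Tendsto (fun s => ‖g s‖) (𝓝[{s | 0 < s.im}] (t : ℂ)) (𝓝 1)) :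
    ∃ δ, 0 < δ ∧ δ ≤ ε ∧ ∃ F : ℂ → ℂ, DifferentiableOn ℂ F (Metric.ball 0 δ) ∧
      (∀ s ∈ Metric.ball (0 : ℂ) δ, 0 < s.im → F s = g s) ∧
      (∀ s ∈ Metric.ball (0 : ℂ) δ, s.im < 0 →
        F s = (starRingEnd ℂ (g (starRingEnd ℂ s)))⁻¹) ∧
      (∀ s ∈ Metric.ball (0 : ℂ) δ, s.im = 0 → ‖F s‖ = 1) := by
  have hup : IsOpen {s : ℂ | 0 < s.im} := isOpen_lt continuous_const Complex.continuous_im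
  obtain ⟨δ₁, hδ₁, h1⟩ := Metric.tendsto_nhdsWithin_nhds.1 (hlim 0 (by simpa using hε)) (1 / 2)
    (by norm_num)
  set δ := min δ₁ ε with hδ
  have hδ0 : 0 < δ := lt_min hδ₁ hε
  have hδε : δ ≤ ε := min_le_right _ _
  have hbd : ∀ s ∈ Metric.ball (0 : ℂ) δ ∩ {s | 0 < s.im}, 1 / 2 ≤ ‖g s‖ ∧ ‖g s‖ ≤ 2 := by
    rintro s ⟨hs, hs'⟩
    have := h1 hs' (by simpa using (Metric.mem_ball.1 hs).trans_le (min_le_left _ _))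
    rw [Real.dist_eq, abs_lt] at this
    constructor <;> linarith
  have hconj : ∀ s ∈ Metric.ball (0 : ℂ) δ ∩ {s | s.im < 0},
      starRingEnd ℂ s ∈ Metric.ball (0 : ℂ) δ ∩ {s | 0 < s.im} := by
    rintro s ⟨hs, hs'⟩
    exact ⟨by simpa using hs, by simpa using hs'⟩
  have hne : ∀ s ∈ Metric.ball (0 : ℂ) δ ∩ {s | 0 < s.im}, g s ≠ 0 := by
    intro s hs h0
    have := (hbd s hs).1
    rw [h0, norm_zero] at this
    norm_num at this
  have hsub : Metric.ball (0 : ℂ) δ ∩ {s | 0 < s.im} ⊆ Metric.ball (0 : ℂ) ε ∩ {s | 0 < s.im} :=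
    inter_subset_inter_left _ (Metric.ball_subset_ball hδε)
  obtain ⟨F, hF, hF1, hF2⟩ := exists_differentiableOn_ball_of_jump_zero (g₁ := g)
    (g₂ := fun s => (starRingEnd ℂ (g (starRingEnd ℂ s)))⁻¹) (ε := δ) (C := 2) hδ0
    (hg.mono hsub)
    (by
      intro s hs
      have hs' := hconj s hs
      have hd : DifferentiableAt ℂ g (starRingEnd ℂ s) :=
        (hg.mono hsub).differentiableAt ((Metric.isOpen_ball.inter hup).mem_nhds hs')
      have := hd.conj_conj
      rw [Complex.conj_conj] at this
      refine (this.inv ?_).differentiableWithinAt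
      simpa using hne _ hs')
    (fun s hs => (hbd s hs).2)
    (by
      intro s hs
      have := (hbd _ (hconj s hs)).1
      rw [norm_inv, RCLike.norm_conj]
      rw [inv_le_comm₀ (by linarith) (by norm_num)]
      norm_num at this ⊢
      exact this)
    (by
      intro t ht
      have hl := hlim t (ht.trans_le hδε)
      -- The jump is `g - 1 / conj g = (‖g‖² - 1) / conj g`, so only the modulus of `g` enters.
      have hl2 : Tendsto (fun s => |‖g s‖ ^ 2 - 1| / ‖g s‖) (𝓝[{s | 0 < s.im}] (t : ℂ)) (𝓝 0) := by
        have := (((hl.pow 2).sub_const 1).abs).div hl one_ne_zero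
        simpa [Pi.div_def] using this
      rw [tendsto_zero_iff_norm_tendsto_zero]
      refine hl2.congr' ?_
      have hm : ∀ᶠ s in 𝓝[{s | 0 < s.im}] (t : ℂ), s ∈ Metric.ball (0 : ℂ) δ ∩ {s | 0 < s.im} :=
        inter_mem (nhdsWithin_le_nhds (Metric.isOpen_ball.mem_nhds (by simpa using ht)))
          self_mem_nhdsWithin
      filter_upwards [hm] with s hs
      have h0 := hne s hs
      have h0' : starRingEnd ℂ (g s) ≠ 0 := by simpa using h0
      rw [Complex.conj_conj]
      have : g s - (starRingEnd ℂ (g s))⁻¹ = ((‖g s‖ ^ 2 - 1 : ℝ) : ℂ) / starRingEnd ℂ (g s) := by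
        rw [eq_div_iff h0', sub_mul, inv_mul_cancel₀ h0', Complex.mul_conj,
          Complex.normSq_eq_norm_sq]
        push_cast; ring
      rw [this, norm_div, RCLike.norm_conj, Complex.norm_real, Real.norm_eq_abs])
  refine ⟨δ, hδ0, hδε, F, hF, hF1, hF2, ?_⟩
  intro s hs hs0
  have hsre : ((s.re : ℝ) : ℂ) = s := by apply Complex.ext <;> simp [hs0]
  have hsre' : |s.re| < ε := by
    have := (Complex.abs_re_le_norm s).trans_lt (by simpa using hs)
    exact this.trans_le hδε
  have hl := hlim s.re hsre'
  rw [hsre] at hl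
  have hc : Tendsto (fun w => ‖F w‖) (𝓝[{s | 0 < s.im}] s) (𝓝 ‖F s‖) :=
    ((hF.differentiableAt (Metric.isOpen_ball.mem_nhds hs)).continuousAt.norm).tendsto.mono_left
      nhdsWithin_le_nhds
  have : (𝓝[{s : ℂ | 0 < s.im}] s).NeBot := by
    rw [← mem_closure_iff_nhdsWithin_neBot, Complex.closure_setOfPred_lt_im]
    simp [hs0]
  refine tendsto_nhds_unique hc (hl.congr' ?_)
  filter_upwards [self_mem_nhdsWithin, nhdsWithin_le_nhds (Metric.isOpen_ball.mem_nhds hs)]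
    with w hw hw'
  rw [hF1 w hw' hw]

/-! ### Analytic closed curves: local charts and topology -/

theorem Function.Periodic.exists_eq_add_of_injOn {γ : ℝ → ℂ} {T : ℝ} (hT : 0 < T)
    (hp : Function.Periodic γ T) (hi : InjOn γ (Ico 0 T)) {a b : ℝ} (h : γ a = γ b) :
    ∃ k : ℤ, a = b + k * T := by
  have ha := toIcoMod_mem_Ico hT 0 a
  have hb := toIcoMod_mem_Ico hT 0 b
  rw [zero_add] at ha hb
  have hval : ∀ c, γ (toIcoMod hT 0 c) = γ c := fun c => by
    rw [← self_sub_toIcoDiv_zsmul hT 0 c]; exact hp.sub_zsmul_eq _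
  have he := hi ha hb (by rw [hval, hval, h])
  rw [← self_sub_toIcoDiv_zsmul hT 0 a, ← self_sub_toIcoDiv_zsmul hT 0 b] at he
  refine ⟨toIcoDiv hT 0 a - toIcoDiv hT 0 b, ?_⟩
  simp only [zsmul_eq_mul] at he
  push_cast
  linarith

/-- An analytic closed curve is straightened by a holomorphic chart near each of its points. -/
theorem IsAnalyticClosedCurve.exists_chart {Γ : Set ℂ} (hΓ : IsAnalyticClosedCurve Γ) {x : ℂ}
    (hx : x ∈ Γ) : ∃ ε, 0 < ε ∧ ∃ e : ℂ → ℂ, AnalyticOnNhd ℂ e (Metric.ball 0 ε) ∧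
      InjOn e (Metric.ball 0 ε) ∧ e 0 = x ∧ ∀ s ∈ Metric.ball (0 : ℂ) ε, (e s ∈ Γ ↔ s.im = 0) := by
  obtain ⟨γ, han, hper, hd, hinj, rfl⟩ := hΓ
  obtain ⟨t₀, rfl⟩ := hx
  have hpi := Real.pi_pos
  obtain ⟨g, hg, hgγ⟩ := (han t₀ (mem_univ _)).exists_complex_extension
  have hgt : g t₀ = γ t₀ := hgγ.self_of_nhds
  have hg' : deriv g t₀ ≠ 0 := by
    have h1 : HasDerivAt (fun s : ℝ => g s) (deriv g t₀) t₀ :=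
      hg.differentiableAt.hasDerivAt.comp_ofReal
    have h2 := h1.congr_of_eventuallyEq (f₁ := γ) (by filter_upwards [hgγ] with s hs using hs.symm)
    rw [← h2.deriv]; exact hd t₀
  have hleft := hg.hasStrictDerivAt.eventually_left_inverse hg'
  set l := hg.hasStrictDerivAt.localInverse g _ _ hg'
  obtain ⟨ε₁, hε₁, hball⟩ := Metric.eventually_nhds_iff_ball.1 (hleft.and hg.eventually_analyticAt)
  obtain ⟨ε₂, hε₂, hball₂⟩ := Metric.eventually_nhds_iff_ball.1 hgγ
  have hinjg : InjOn g (Metric.ball (t₀ : ℂ) ε₁) := fun a ha b hb hab => by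
    rw [← (hball a ha).1, ← (hball b hb).1, hab]
  set r := min ε₁ ε₂ with hr
  have hr0 : 0 < r := lt_min hε₁ hε₂
  -- The part of the curve, over one period centred at `t₀`, with parameter at distance at least `r`
  -- from `t₀`. It is compact and misses `γ t₀` by injectivity, so near that point the curve
  -- consists only of the arc straightened by `g`.
  set N := γ '' (Icc (t₀ - Real.pi) (t₀ + Real.pi) ∩ {t | r ≤ |t - t₀|}) with hN
  have hcγ : Continuous γ := continuous_iff_continuousAt.2 fun t =>
    (han t (mem_univ _)).continuousAt
  have hNc : IsCompact N := (isCompact_Icc.inter_right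
    (isClosed_le continuous_const (by fun_prop))).image hcγ
  have hxN : g t₀ ∉ N := by
    rw [hgt]
    rintro ⟨t, ⟨ht, ht'⟩, hteq⟩
    obtain ⟨k, hk⟩ := hper.exists_eq_add_of_injOn (by positivity) hinj hteq
    have hk0 : k = 0 := by
      have h1 : (k : ℝ) * (2 * Real.pi) ≤ Real.pi := by linarith [ht.2]
      have h2 : -Real.pi ≤ (k : ℝ) * (2 * Real.pi) := by linarith [ht.1]
      have h3 : (k : ℝ) < 1 := by
        by_contra h; push Not at h; nlinarith
      have h4 : (-1 : ℝ) < k := by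
        by_contra h; push Not at h; nlinarith
      have h3' : k < 1 := by exact_mod_cast h3
      have h4' : -1 < k := by exact_mod_cast h4
      omega
    rw [hk0] at hk
    have : |t - t₀| = 0 := by rw [hk]; simp
    have ht'' : r ≤ |t - t₀| := ht'
    linarith
  have hnb : g ⁻¹' Nᶜ ∈ 𝓝 (t₀ : ℂ) :=
    hg.continuousAt.preimage_mem_nhds (hNc.isClosed.isOpen_compl.mem_nhds hxN)
  obtain ⟨ε₃, hε₃, hball₃⟩ := Metric.mem_nhds_iff.1 hnb
  set ε := min r ε₃ with hε
  have hεr : ε ≤ r := min_le_left _ _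
  have hmem : ∀ s ∈ Metric.ball (0 : ℂ) ε, (t₀ : ℂ) + s ∈ Metric.ball (t₀ : ℂ) ε := by
    intro s hs; simpa using hs
  have hsub₁ : Metric.ball (t₀ : ℂ) ε ⊆ Metric.ball (t₀ : ℂ) ε₁ :=
    Metric.ball_subset_ball (hεr.trans (min_le_left _ _))
  refine ⟨ε, lt_min hr0 hε₃, fun s => g (t₀ + s), ?_, ?_, by simp [hgt], ?_⟩
  · intro s hs
    exact (hball _ (hsub₁ (hmem s hs))).2.comp (by fun_prop)
  · intro a ha b hb hab
    exact add_left_cancel (hinjg (hsub₁ (hmem a ha)) (hsub₁ (hmem b hb)) hab)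
  · intro s hs
    constructor
    · rintro ⟨t, ht⟩
      obtain ⟨t', ht', htt'⟩ := hper.exists_mem_Ico (by positivity) t (t₀ - Real.pi)
      rw [htt'] at ht
      have h1 : g (t₀ + s) ∉ N :=
        hball₃ (Metric.ball_subset_ball (min_le_right _ _) (hmem s hs))
      have h2 : |t' - t₀| < r := by
        by_contra h
        push Not at h
        exact h1 ⟨t', ⟨⟨ht'.1, by linarith [ht'.2]⟩, h⟩, ht⟩
      have h3 : g t' = γ t' := hball₂ t' (by
        rw [Metric.mem_ball, Real.dist_eq]; exact h2.trans_le (min_le_right _ _))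
      have h4 := hinjg (x₁ := (t' : ℂ)) (x₂ := t₀ + s) (by
        rw [Metric.mem_ball, dist_eq_norm, ← Complex.ofReal_sub, Complex.norm_real]
        exact h2.trans_le (min_le_left _ _)) (hsub₁ (hmem s hs)) (by rw [h3, ht])
      have h5 := congrArg Complex.im h4
      simpa using h5.symm
    · intro h0
      have hsre : ((s.re : ℝ) : ℂ) = s := by apply Complex.ext <;> simp [h0]
      refine ⟨t₀ + s.re, ?_⟩
      rw [← hball₂ (t₀ + s.re) ?_]
      · push_cast; rw [hsre]
      · rw [Metric.mem_ball, Real.dist_eq, add_sub_cancel_left]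
        refine ((Complex.abs_re_le_norm s).trans_lt (by simpa using hs)).trans_le
          (hεr.trans (min_le_right _ _))

theorem IsAnalyticClosedCurve.isPreconnected {Γ : Set ℂ} (hΓ : IsAnalyticClosedCurve Γ) :
    IsPreconnected Γ := by
  obtain ⟨γ, han, -, -, -, rfl⟩ := hΓ
  exact isPreconnected_range (continuous_iff_continuousAt.2 fun t =>
    (han t (mem_univ _)).continuousAt)

/-- Otherwise the identity would lift through the covering by `ℝ` to a section `s`. Then `t ↦ s t`
and `id` lift the same map and agree at `0`, so they coincide; but `s` takes the same value at the
parameters `0` and `T`. -/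
theorem AddCircle.not_simplyConnectedSpace (T : ℝ) [hT : Fact (0 < T)] :
    ¬ SimplyConnectedSpace (AddCircle T) := by
  intro h
  have : LocallyPathConnectedSpace (AddCircle T) :=
    (QuotientAddGroup.isQuotientMap_mk (N := AddSubgroup.zmultiples T)).locallyPathConnectedSpace
  have cov := AddCircle.isCoveringMap_coe (𝕜 := ℝ) T
  obtain ⟨s, ⟨hs0, hs⟩, -⟩ := cov.existsUnique_continuousMap_lifts
    (ContinuousMap.id (AddCircle T)) (0 : AddCircle T) (0 : ℝ) (by simp)
  have : (fun t : ℝ => s (t : AddCircle T)) = id := by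
    refine cov.eq_of_comp_eq (s.continuous.comp (AddCircle.continuous_mk' T)) continuous_id ?_ 0 ?_
    · funext t
      exact congrFun hs (t : AddCircle T)
    · simpa using hs0
  have h1 := congrFun this T
  simp only [AddCircle.coe_period, id] at h1
  rw [hs0] at h1
  exact hT.out.ne h1

/-- The parametrisation descends to a continuous bijection from a compact circle onto the curve,
hence a homeomorphism. -/
theorem IsAnalyticClosedCurve.not_isSimplyConnected {Γ : Set ℂ} (hΓ : IsAnalyticClosedCurve Γ) :
    ¬ IsSimplyConnected Γ := by
  obtain ⟨γ, han, hper, -, hinj, rfl⟩ := hΓ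
  intro hs
  have hcγ : Continuous γ := continuous_iff_continuousAt.2 fun t =>
    (han t (mem_univ _)).continuousAt
  have : Fact (0 < 2 * Real.pi) := ⟨Real.two_pi_pos⟩
  have hper' : Function.Periodic (rangeFactorization γ) (2 * Real.pi) := fun t =>
    Subtype.ext (hper t)
  set L : AddCircle (2 * Real.pi) → range γ := hper'.lift
  have hLc : Continuous L := continuous_quot_lift _ (by fun_prop)
  have hLb : Function.Bijective L := by
    constructor
    · intro a b
      induction a using QuotientAddGroup.induction_on with | _ a =>
      induction b using QuotientAddGroup.induction_on with | _ b =>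
      intro hab
      obtain ⟨k, hk⟩ := hper.exists_eq_add_of_injOn (by positivity) hinj (congrArg Subtype.val hab)
      rw [hk]
      simp [← zsmul_eq_mul]
    · rintro ⟨_, t, rfl⟩
      exact ⟨(t : AddCircle _), rfl⟩
  have e : AddCircle (2 * Real.pi) ≃ₜ range γ :=
    hLc.homeoOfEquivCompactToT2 (f := Equiv.ofBijective L hLb)
  have := hs.simplyConnectedSpace
  exact AddCircle.not_simplyConnectedSpace (2 * Real.pi)
    e.toHomotopyEquiv.simplyConnectedSpace

/-! ### The unbounded component and the sides of its boundary -/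

theorem isOpen_unboundedComponent {K : Set ℂ} (hK : IsClosed K) :
    IsOpen (unboundedComponent K) := by
  rw [isOpen_iff_mem_nhds]
  rintro z ⟨hz, hz'⟩
  filter_upwards [(hK.isOpen_compl.connectedComponentIn (x := z)).mem_nhds
    (mem_connectedComponentIn hz)] with y hy
  exact ⟨connectedComponentIn_subset _ _ hy, by rwa [← connectedComponentIn_eq hy]⟩

theorem frontier_unboundedComponent_subset {K : Set ℂ} (hK : IsClosed K) :
    frontier (unboundedComponent K) ⊆ K := by
  intro x hx
  by_contra hxK
  have hopen := hK.isOpen_compl.connectedComponentIn (x := x)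
  obtain ⟨y, hy, hy'⟩ := mem_closure_iff_nhds.1 hx.1 _
    (hopen.mem_nhds (mem_connectedComponentIn hxK))
  rw [(isOpen_unboundedComponent hK).frontier_eq] at hx
  exact hx.2 ⟨hxK, by rw [connectedComponentIn_eq hy]; exact hy'.2⟩

/-- If the unbounded component were dense, its frontier would be all of `K`, and a closed curve is
not simply connected. This is where simple connectivity of `K` enters, and it replaces the Jordan
curve theorem. -/
theorem closure_unboundedComponent_ne_univ {K : Set ℂ} (hK : IsClosed K)
    (hKs : IsSimplyConnected K) (hΓ : IsAnalyticClosedCurve (frontier (unboundedComponent K))) :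
    closure (unboundedComponent K) ≠ univ := by
  intro h
  have : frontier (unboundedComponent K) = K := by
    refine (frontier_unboundedComponent_subset hK).antisymm fun x hx => ?_
    rw [(isOpen_unboundedComponent hK).frontier_eq, h]
    exact ⟨mem_univ _, fun h => h.1 hx⟩
  rw [this] at hΓ
  exact hΓ.not_isSimplyConnected hKs

/-- A connected set missing the frontier of an open set lies inside it or off its closure. -/
theorem IsPreconnected.subset_or_subset_compl_closure {Ω S : Set ℂ} (hΩ : IsOpen Ω)
    (hS : IsPreconnected S) (h : ∀ x ∈ S, x ∉ frontier Ω) : S ⊆ Ω ∨ S ⊆ (closure Ω)ᶜ := by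
  refine hS.subset_or_subset hΩ isClosed_closure.isOpen_compl
    (disjoint_compl_right.mono_left subset_closure) fun x hx => ?_
  by_cases hxc : x ∈ closure Ω
  · left
    by_contra hxΩ
    exact h x hx (by rw [hΩ.frontier_eq]; exact ⟨hxc, hxΩ⟩)
  · right; exact hxc

section Charts

variable {Ω : Set ℂ} {ε : ℝ} {e : ℂ → ℂ}

theorem upper_half_subset_or (hΩ : IsOpen Ω) (he : ContinuousOn e (Metric.ball 0 ε))
    (heΓ : ∀ s ∈ Metric.ball (0 : ℂ) ε, (e s ∈ frontier Ω ↔ s.im = 0)) :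
    (∀ s ∈ Metric.ball (0 : ℂ) ε, 0 < s.im → e s ∈ Ω) ∨
      (∀ s ∈ Metric.ball (0 : ℂ) ε, 0 < s.im → e s ∉ closure Ω) := by
  have hc : IsPreconnected (e '' (Metric.ball (0 : ℂ) ε ∩ {s | 0 < s.im})) :=
    ((convex_ball _ _).inter (convex_halfSpace_im_gt 0)).isPreconnected.image _
      (he.mono inter_subset_left)
  rcases hc.subset_or_subset_compl_closure hΩ (by
    rintro _ ⟨s, ⟨hs, hs'⟩, rfl⟩ h
    exact (show 0 < s.im from hs').ne' ((heΓ s hs).1 h)) with h | h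
  · exact .inl fun s hs hs' => h ⟨s, ⟨hs, hs'⟩, rfl⟩
  · exact .inr fun s hs hs' => h ⟨s, ⟨hs, hs'⟩, rfl⟩

theorem notMem_interior_closure_of_upper_half (he : ContinuousOn e (Metric.ball 0 ε))
    (h : ∀ s ∈ Metric.ball (0 : ℂ) ε, 0 < s.im → e s ∉ closure Ω)
    {s : ℂ} (hs : s ∈ Metric.ball (0 : ℂ) ε) (hs0 : s.im = 0) : e s ∉ interior (closure Ω) := by
  intro hint
  have h1 := (he.continuousAt (Metric.isOpen_ball.mem_nhds hs)).preimage_mem_nhds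
    (isOpen_interior.mem_nhds hint)
  have h2 : s ∈ closure {s : ℂ | 0 < s.im} := by
    rw [Complex.closure_setOfPred_lt_im]; simp [hs0]
  obtain ⟨w, ⟨hw1, hw2⟩, hw3⟩ := mem_closure_iff_nhds.1 h2 _
    (inter_mem h1 (Metric.isOpen_ball.mem_nhds hs))
  exact h w hw2 hw3 (interior_subset hw1)

/-- The chart `s ↦ e (-s)`. -/
theorem chart_neg {x : ℂ} {Γ : Set ℂ} (he : AnalyticOnNhd ℂ e (Metric.ball 0 ε))
    (hi : InjOn e (Metric.ball 0 ε)) (h0 : e 0 = x)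
    (heΓ : ∀ s ∈ Metric.ball (0 : ℂ) ε, (e s ∈ Γ ↔ s.im = 0)) :
    AnalyticOnNhd ℂ (fun s => e (-s)) (Metric.ball 0 ε) ∧
      InjOn (fun s => e (-s)) (Metric.ball 0 ε) ∧ e (-0) = x ∧
      ∀ s ∈ Metric.ball (0 : ℂ) ε, (e (-s) ∈ Γ ↔ s.im = 0) := by
  have hm : ∀ s ∈ Metric.ball (0 : ℂ) ε, -s ∈ Metric.ball (0 : ℂ) ε := fun s hs => by
    simpa using hs
  exact ⟨fun s hs => (he _ (hm s hs)).fun_comp (by fun_prop),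
    fun a ha b hb hab => neg_injective (hi (hm a ha) (hm b hb) hab), by simpa using h0,
    fun s hs => by rw [heΓ _ (hm s hs)]; simp⟩

/-- Lying in the interior of `closure Ω` is an open and closed condition along the curve: in a chart
either both half discs lie in `Ω`, or one avoids `closure Ω` and bars every boundary point of the
chart. By connectedness it holds everywhere or nowhere. Everywhere would make `closure Ω` clopen,
hence empty or the whole plane. -/
theorem frontier_notMem_interior_closure (hΩ : IsOpen Ω)
    (hΓ : IsAnalyticClosedCurve (frontier Ω)) (hcl : closure Ω ≠ univ) :
    ∀ x ∈ frontier Ω, x ∉ interior (closure Ω) := by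
  set V := interior {y | y ∈ frontier Ω → y ∉ interior (closure Ω)} with hV
  have hVx : ∀ x ∈ frontier Ω, x ∉ interior (closure Ω) → x ∈ V := by
    intro x hx hxi
    obtain ⟨ε, hε, e, he, hi, h0, heΓ⟩ := hΓ.exists_chart hx
    obtain ⟨he', hi', h0', heΓ'⟩ := chart_neg he hi h0 heΓ
    have hcont : ContinuousOn e (Metric.ball 0 ε) := he.continuousOn
    have hopen : e '' Metric.ball 0 ε ∈ 𝓝 x := by
      refine (Set.InjOn.isOpen_image_of_analyticOnNhd he hi Metric.isOpen_ball Subset.rfl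
        Metric.isOpen_ball).mem_nhds ⟨0, Metric.mem_ball_self hε, h0⟩
    rw [hV, mem_interior_iff_mem_nhds]
    have hall : ∀ s ∈ Metric.ball (0 : ℂ) ε, s.im = 0 → e s ∉ interior (closure Ω) := by
      rcases upper_half_subset_or hΩ hcont heΓ with h1 | h1
      · rcases upper_half_subset_or hΩ he'.continuousOn heΓ' with h2 | h2
        · exfalso
          apply hxi
          rw [mem_interior_iff_mem_nhds]
          filter_upwards [hopen]
          rintro _ ⟨s, hs, rfl⟩
          rcases lt_trichotomy s.im 0 with h | h | h
          · have := h2 (-s) (by simpa using hs) (by simpa using h)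
            rw [neg_neg] at this
            exact subset_closure this
          · exact frontier_subset_closure ((heΓ s hs).2 h)
          · exact subset_closure (h1 s hs h)
        · intro s hs hs0
          have := notMem_interior_closure_of_upper_half he'.continuousOn h2 (s := -s)
            (by simpa using hs) (by simpa using hs0)
          simpa using this
      · exact fun s hs hs0 => notMem_interior_closure_of_upper_half hcont h1 hs hs0
    filter_upwards [hopen]
    rintro _ ⟨s, hs, rfl⟩ hsΓ
    exact hall s hs ((heΓ s hs).1 hsΓ)
  rcases isPreconnected_iff_subset_of_disjoint.1 hΓ.isPreconnected (interior (closure Ω)) V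
    isOpen_interior isOpen_interior (fun x hx => by
      by_cases h : x ∈ interior (closure Ω)
      · exact .inl h
      · exact .inr (hVx x hx h))
    (by
      ext x
      simp only [mem_inter_iff, mem_empty_iff_false, iff_false]
      rintro ⟨h1, h2, h3⟩
      exact interior_subset h3 h1 h2) with h | h
  · exfalso
    have hop : IsOpen (closure Ω) := by
      have : closure Ω ⊆ interior (closure Ω) := by
        intro x hx
        by_cases hxΩ : x ∈ Ω
        · exact interior_maximal subset_closure hΩ hxΩ
        · exact h (by rw [hΩ.frontier_eq]; exact ⟨hx, hxΩ⟩)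
      exact interior_eq_iff_isOpen.1 (interior_subset.antisymm this)
    rcases isClopen_iff.1 ⟨isClosed_closure, hop⟩ with h | h
    · rw [closure_empty_iff] at h
      obtain ⟨γ, -, -, -, -, hγ⟩ := hΓ
      have : γ 0 ∈ frontier Ω := hγ ▸ mem_range_self 0
      simp [h] at this
    · exact hcl h
  · exact fun x hx => interior_subset (h hx) hx

/-- Near a point of an analytic boundary curve, the domain is the image of a half disc under a
holomorphic chart. -/
theorem exists_oneSided_chart (hΩ : IsOpen Ω)
    (hΓ : IsAnalyticClosedCurve (frontier Ω)) (hcl : closure Ω ≠ univ) {x : ℂ}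
    (hx : x ∈ frontier Ω) : ∃ ε, 0 < ε ∧ ∃ e : ℂ → ℂ, AnalyticOnNhd ℂ e (Metric.ball 0 ε) ∧
      InjOn e (Metric.ball 0 ε) ∧ e 0 = x ∧
      (∀ s ∈ Metric.ball (0 : ℂ) ε, 0 < s.im → e s ∈ Ω) ∧
      (∀ s ∈ Metric.ball (0 : ℂ) ε, s.im = 0 → e s ∈ frontier Ω) ∧
      (∀ s ∈ Metric.ball (0 : ℂ) ε, s.im < 0 → e s ∉ closure Ω) := by
  have hone := frontier_notMem_interior_closure hΩ hΓ hcl x hx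
  obtain ⟨ε, hε, e, he, hi, h0, heΓ⟩ := hΓ.exists_chart hx
  obtain ⟨he', hi', h0', heΓ'⟩ := chart_neg he hi h0 heΓ
  have hopen : e '' Metric.ball 0 ε ∈ 𝓝 x := by
    refine (Set.InjOn.isOpen_image_of_analyticOnNhd he hi Metric.isOpen_ball Subset.rfl
      Metric.isOpen_ball).mem_nhds ⟨0, Metric.mem_ball_self hε, h0⟩
  -- Both halves inside would put `x` in the interior of the closure; both outside would separate
  -- `x` from `Ω`. In the mixed cases `s ↦ -s` puts `Ω` on top if needed.
  rcases upper_half_subset_or hΩ he.continuousOn heΓ with h1 | h1 <;>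
  rcases upper_half_subset_or hΩ he'.continuousOn heΓ' with h2 | h2
  · exfalso
    apply hone
    rw [mem_interior_iff_mem_nhds]
    filter_upwards [hopen]
    rintro _ ⟨s, hs, rfl⟩
    rcases lt_trichotomy s.im 0 with h | h | h
    · have := h2 (-s) (by simpa using hs) (by simpa using h)
      rw [neg_neg] at this
      exact subset_closure this
    · exact frontier_subset_closure ((heΓ s hs).2 h)
    · exact subset_closure (h1 s hs h)
  · refine ⟨ε, hε, e, he, hi, h0, h1, fun s hs => (heΓ s hs).2, fun s hs hs0 => ?_⟩
    have := h2 (-s) (by simpa using hs) (by simpa using hs0)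
    simpa using this
  · refine ⟨ε, hε, fun s => e (-s), he', hi', h0', h2, fun s hs => (heΓ' s hs).2,
      fun s hs hs0 => h1 (-s) (by simpa using hs) (by simpa using hs0)⟩
  · exfalso
    obtain ⟨y, ⟨s, hs, rfl⟩, hy⟩ := mem_closure_iff_nhds.1 hx.1 _ hopen
    rcases lt_trichotomy s.im 0 with h | h | h
    · have := h2 (-s) (by simpa using hs) (by simpa using h)
      rw [neg_neg] at this
      exact this (subset_closure hy)
    · have := (heΓ s hs).2 h
      rw [hΩ.frontier_eq] at this
      exact this.2 hy
    · exact h1 s hs h (subset_closure hy)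

end Charts

/-! ### Conformal maps onto the punctured disc: behaviour at the puncture and at the boundary -/

theorem isOpen_puncturedDisc : IsOpen {u : ℂ | u ≠ 0 ∧ ‖u‖ < 1} :=
  isOpen_ne.inter (isOpen_lt continuous_norm continuous_const)

theorem eventually_mem_puncturedDisc : ∀ᶠ u : ℂ in 𝓝[≠] 0, u ≠ 0 ∧ ‖u‖ < 1 := by
  filter_upwards [self_mem_nhdsWithin,
    nhdsWithin_le_nhds (Metric.ball_mem_nhds (0 : ℂ) one_pos)] with u h1 h2
  exact ⟨h1, by simpa using h2⟩

/-- `φ` maps the domain `Ω`, bounded by an analytic curve, conformally onto the punctured unit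
disc, with inverse `X`. -/
structure IsPuncturedDiscMap (Ω : Set ℂ) (φ X : ℂ → ℂ) : Prop where
  isOpen : IsOpen Ω
  curve : IsAnalyticClosedCurve (frontier Ω)
  closure_ne : closure Ω ≠ univ
  diff : DifferentiableOn ℂ φ Ω
  norm_lt : ∀ z ∈ Ω, ‖φ z‖ < 1
  ne_zero : ∀ z ∈ Ω, φ z ≠ 0
  mem : ∀ u, u ≠ 0 → ‖u‖ < 1 → X u ∈ Ω
  left_inv : ∀ z ∈ Ω, X (φ z) = z
  right_inv : ∀ u, u ≠ 0 → ‖u‖ < 1 → φ (X u) = u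

namespace IsPuncturedDiscMap

variable {Ω : Set ℂ} {φ X : ℂ → ℂ}

theorem injOn (H : IsPuncturedDiscMap Ω φ X) : InjOn φ Ω := fun a ha b hb hab => by
  rw [← H.left_inv a ha, ← H.left_inv b hb, hab]

theorem injOn_inv (H : IsPuncturedDiscMap Ω φ X) : InjOn X {u | u ≠ 0 ∧ ‖u‖ < 1} :=
    fun a ha b hb hab => by
  rw [← H.right_inv a ha.1 ha.2, ← H.right_inv b hb.1 hb.2, hab]

theorem differentiableAt_inv (H : IsPuncturedDiscMap Ω φ X) {u : ℂ} (h0 : u ≠ 0) (h1 : ‖u‖ < 1) :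
    DifferentiableAt ℂ X u := by
  have := Set.InjOn.differentiableAt_leftInverse (H.diff.analyticOnNhd H.isOpen) H.injOn H.isOpen
    H.left_inv (H.mem u h0 h1)
  rwa [H.right_inv u h0 h1] at this

theorem deriv_inv_ne_zero (H : IsPuncturedDiscMap Ω φ X) {u : ℂ} (h0 : u ≠ 0) (h1 : ‖u‖ < 1) :
    deriv X u ≠ 0 :=
  Set.InjOn.deriv_ne_zero_of_analyticOnNhd (U := {u : ℂ | u ≠ 0 ∧ ‖u‖ < 1})
    (DifferentiableOn.analyticOnNhd (fun _ hv =>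
      (H.differentiableAt_inv hv.1 hv.2).differentiableWithinAt) isOpen_puncturedDisc)
    H.injOn_inv isOpen_puncturedDisc ⟨h0, h1⟩

/-- A finite limit `a` lies in `closure Ω` but not in `Ω`, because `φ` does not vanish there.
Filling the puncture with `a` gives an injective, hence open, map of the disc, so the boundary point
`a` would be interior to `closure Ω`. -/
theorem not_tendsto_nhds (H : IsPuncturedDiscMap Ω φ X) (a : ℂ) : ¬ Tendsto X (𝓝[≠] 0) (𝓝 a) := by
  intro ha
  have hcl : a ∈ closure Ω := mem_closure_of_tendsto ha (by
    filter_upwards [eventually_mem_puncturedDisc] with u hu using H.mem u hu.1 hu.2)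
  have hnot : a ∉ Ω := by
    intro haΩ
    have h1 : Tendsto (fun u => φ (X u)) (𝓝[≠] 0) (𝓝 (φ a)) :=
      ((H.diff.differentiableAt (H.isOpen.mem_nhds haΩ)).continuousAt.tendsto).comp ha
    have h2 : Tendsto (fun u => φ (X u)) (𝓝[≠] 0) (𝓝 0) := by
      refine (tendsto_id.mono_left nhdsWithin_le_nhds).congr' ?_
      filter_upwards [eventually_mem_puncturedDisc] with u hu using (H.right_inv u hu.1 hu.2).symm
    exact H.ne_zero a haΩ (tendsto_nhds_unique h1 h2)
  set Y := Function.update X 0 a with hY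
  have hYX : ∀ u, u ≠ 0 → Y u = X u := fun u hu => Function.update_of_ne hu _ _
  have hY0 : Y 0 = a := Function.update_self ..
  have hYd : DifferentiableOn ℂ Y (Metric.ball 0 1) := by
    rw [← Complex.differentiableOn_compl_singleton_and_continuousAt_iff
      (Metric.ball_mem_nhds (0 : ℂ) one_pos)]
    refine ⟨fun u hu => ?_, continuousAt_update_same.2 ha⟩
    have h0 : u ≠ 0 := hu.2
    refine ((H.differentiableAt_inv h0 (by simpa using hu.1)).congr_of_eventuallyEq
      ?_).differentiableWithinAt
    filter_upwards [isOpen_ne.mem_nhds h0] with v hv using hYX v hv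
  have hYi : InjOn Y (Metric.ball 0 1) := by
    intro u hu v hv huv
    have hu' : ‖u‖ < 1 := by simpa using hu
    have hv' : ‖v‖ < 1 := by simpa using hv
    by_cases h0 : u = 0 <;> by_cases h1 : v = 0
    · rw [h0, h1]
    · rw [h0, hY0, hYX v h1] at huv
      exact absurd (huv ▸ H.mem v h1 hv') hnot
    · rw [h1, hY0, hYX u h0] at huv
      exact absurd (huv ▸ H.mem u h0 hu') hnot
    · rw [hYX u h0, hYX v h1] at huv
      exact H.injOn_inv ⟨h0, hu'⟩ ⟨h1, hv'⟩ huv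
  have hop := (Set.InjOn.isOpen_image_of_analyticOnNhd (hYd.analyticOnNhd Metric.isOpen_ball) hYi
    Metric.isOpen_ball Subset.rfl Metric.isOpen_ball).mem_nhds
      ⟨0, Metric.mem_ball_self one_pos, hY0⟩
  refine frontier_notMem_interior_closure H.isOpen H.curve H.closure_ne a
    (by rw [H.isOpen.frontier_eq]; exact ⟨hcl, hnot⟩) (mem_interior_iff_mem_nhds.2 ?_)
  filter_upwards [hop]
  rintro _ ⟨u, hu, rfl⟩
  by_cases h0 : u = 0
  · rwa [h0, hY0]
  · rw [hYX u h0]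
    exact subset_closure (H.mem u h0 (by simpa using hu))

/-- Near the puncture `X` stays away from `b = X (1/2)`, since `‖φ‖ > 1/4` near `b`. So `1 / (X -
b)` is bounded and has a limit there, and a nonzero limit would give `X` a finite one. -/
theorem tendsto_cobounded (H : IsPuncturedDiscMap Ω φ X) :
    Tendsto X (𝓝[≠] 0) (Bornology.cobounded ℂ) := by
  have hhalf : (1 / 2 : ℂ) ≠ 0 ∧ ‖(1 / 2 : ℂ)‖ < 1 := by norm_num
  set b := X (1 / 2) with hb
  have hbΩ : b ∈ Ω := H.mem _ hhalf.1 hhalf.2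
  have hφb : ‖φ b‖ = 1 / 2 := by rw [hb, H.right_inv _ hhalf.1 hhalf.2]; norm_num
  have hc : ∀ᶠ z in 𝓝 b, 1 / 4 < ‖φ z‖ :=
    (H.diff.differentiableAt (H.isOpen.mem_nhds hbΩ)).continuousAt.norm.eventually_const_lt
      (by simp only [hφb]; norm_num)
  obtain ⟨δ, hδ, hball⟩ := Metric.eventually_nhds_iff_ball.1 hc
  have hev : ∀ᶠ u : ℂ in 𝓝[≠] 0, (u ≠ 0 ∧ ‖u‖ < 1) ∧ δ ≤ ‖X u - b‖ := by
    filter_upwards [eventually_mem_puncturedDisc,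
      nhdsWithin_le_nhds (Metric.ball_mem_nhds (0 : ℂ) (show (0 : ℝ) < 1 / 4 by norm_num))]
      with u hu hu'
    refine ⟨hu, ?_⟩
    by_contra h
    push Not at h
    have := hball (X u) (by rwa [Metric.mem_ball, dist_eq_norm])
    rw [H.right_inv u hu.1 hu.2] at this
    have h2 : ‖u‖ < 1 / 4 := by simpa using hu'
    linarith
  have hne : ∀ᶠ u : ℂ in 𝓝[≠] 0, X u - b ≠ 0 := by
    filter_upwards [hev] with u hu
    rw [← norm_pos_iff]; linarith [hu.2]
  have hlim := Complex.tendsto_limUnder_of_differentiable_on_punctured_nhds_of_bounded_under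
    (f := fun u => (X u - b)⁻¹) (c := 0)
    (by
      filter_upwards [hev, hne] with u hu hu'
      exact ((H.differentiableAt_inv hu.1.1 hu.1.2).sub_const b).inv hu')
    (by
      refine ⟨δ⁻¹ + ‖(X 0 - b)⁻¹‖, ?_⟩
      rw [eventually_map]
      filter_upwards [hev] with u hu
      refine (norm_sub_le _ _).trans (add_le_add_left ?_ _)
      rw [norm_inv]
      exact inv_anti₀ hδ hu.2)
  set c := limUnder (𝓝[≠] (0 : ℂ)) (fun u => (X u - b)⁻¹)
  by_cases h0 : c = 0
  · rw [h0] at hlim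
    have h1 : Tendsto (fun u => (X u - b)⁻¹) (𝓝[≠] 0) (𝓝[≠] 0) :=
      tendsto_nhdsWithin_iff.2 ⟨hlim, by
        filter_upwards [hne] with u hu using inv_ne_zero hu⟩
    have h2 := tendsto_inv₀_nhdsNE_zero.comp h1
    have h3 : Tendsto (fun u => X u - b) (𝓝[≠] 0) (Bornology.cobounded ℂ) := by
      refine h2.congr fun u => by simp
    rw [← tendsto_norm_atTop_iff_cobounded] at h3 ⊢
    refine tendsto_atTop_mono' _ ?_ (tendsto_atTop_add_const_right _ (-‖b‖) h3)
    filter_upwards with u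
    have := norm_sub_le (X u) b
    linarith
  · exfalso
    have h1 := (hlim.inv₀ h0).add_const b
    refine H.not_tendsto_nhds (c⁻¹ + b) (h1.congr fun u => by simp)

/-- The inverse map has a simple pole at the origin. -/
theorem simple_pole (H : IsPuncturedDiscMap Ω φ X) : ∃ c : ℂ, c ≠ 0 ∧
    DifferentiableAt ℂ (Function.update (fun u => u * X u) 0 c) 0 ∧
    ∀ δ > 0, ∃ M, ∀ z : ℂ, M < ‖z‖ → z ∈ Ω ∧ ‖φ z‖ < δ := by
  have hinf := H.tendsto_cobounded
  have hne : ∀ᶠ u : ℂ in 𝓝[≠] 0, X u ≠ 0 := by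
    have := (tendsto_norm_atTop_iff_cobounded.2 hinf).eventually_gt_atTop 0
    filter_upwards [this] with u hu using norm_pos_iff.1 hu
  obtain ⟨δ₀, hδ₀, hball⟩ := Metric.mem_nhdsWithin_iff.1 (eventually_mem_puncturedDisc.and hne)
  -- `k = 1/X`, completed by `0`, is injective and holomorphic, so `deriv k 0 ≠ 0` and `u * X u = u
  -- / k u` extends with value `1 / deriv k 0`. Openness of `k` at `0` shows that every large `z` is
  -- `X u` with `u` small.
  set k := Function.update (fun u => (X u)⁻¹) 0 0 with hk
  have hkX : ∀ u, u ≠ 0 → k u = (X u)⁻¹ := fun u hu => Function.update_of_ne hu _ _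
  have hk0 : k 0 = 0 := Function.update_self ..
  have hmem : ∀ u ∈ Metric.ball (0 : ℂ) δ₀, u ≠ 0 → (u ≠ 0 ∧ ‖u‖ < 1) ∧ X u ≠ 0 :=
    fun u hu h0 => hball ⟨hu, h0⟩
  have hkd : DifferentiableOn ℂ k (Metric.ball 0 δ₀) := by
    rw [← Complex.differentiableOn_compl_singleton_and_continuousAt_iff
      (Metric.ball_mem_nhds (0 : ℂ) hδ₀)]
    refine ⟨fun u hu => ?_, continuousAt_update_same.2 (tendsto_inv₀_cobounded.comp hinf)⟩
    have h0 : u ≠ 0 := hu.2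
    have hm := hmem u hu.1 h0
    refine (((H.differentiableAt_inv h0 hm.1.2).inv hm.2).congr_of_eventuallyEq
      ?_).differentiableWithinAt
    filter_upwards [isOpen_ne.mem_nhds h0] with v hv using hkX v hv
  have hki : InjOn k (Metric.ball 0 δ₀) := by
    intro u hu v hv huv
    by_cases h0 : u = 0 <;> by_cases h1 : v = 0
    · rw [h0, h1]
    · rw [h0, hk0, hkX v h1] at huv
      exact absurd huv.symm (inv_ne_zero (hmem v hv h1).2)
    · rw [h1, hk0, hkX u h0] at huv
      exact absurd huv (inv_ne_zero (hmem u hu h0).2)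
    · rw [hkX u h0, hkX v h1] at huv
      exact H.injOn_inv (hmem u hu h0).1 (hmem v hv h1).1 (inv_injective huv)
  have hka := hkd.analyticOnNhd Metric.isOpen_ball
  have h0m := Metric.mem_ball_self (x := (0 : ℂ)) hδ₀
  have hkd0 := Set.InjOn.deriv_ne_zero_of_analyticOnNhd hka hki Metric.isOpen_ball h0m
  refine ⟨(deriv k 0)⁻¹, inv_ne_zero hkd0, ?_, ?_⟩
  · have hds : DifferentiableAt ℂ (dslope k 0) 0 :=
      ((Complex.differentiableOn_dslope (Metric.ball_mem_nhds (0 : ℂ) hδ₀)).2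
        hkd).differentiableAt (Metric.ball_mem_nhds (0 : ℂ) hδ₀)
    have := hds.inv (by rwa [dslope_same])
    refine this.congr_of_eventuallyEq ?_
    filter_upwards [Metric.ball_mem_nhds (0 : ℂ) hδ₀] with u hu
    by_cases h0 : u = 0
    · simp [h0, dslope_same]
    · rw [Function.update_of_ne h0, Pi.inv_apply, dslope_of_ne _ h0, slope_def_field, hk0,
        hkX u h0]
      field_simp
      simp
  · intro δ hδ
    have h1 := Set.InjOn.nhds_le_map_nhds hka hki Metric.isOpen_ball h0m
    rw [hk0] at h1
    have h2 := h1 (image_mem_map (Metric.ball_mem_nhds (0 : ℂ) (lt_min hδ hδ₀)))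
    obtain ⟨η, hη, hsub⟩ := Metric.mem_nhds_iff.1 h2
    refine ⟨η⁻¹, fun z hz => ?_⟩
    have hz0 : 0 < ‖z‖ := (inv_pos.2 hη).trans hz
    obtain ⟨u, hu, huz⟩ := hsub (show z⁻¹ ∈ Metric.ball (0 : ℂ) η by
      rw [mem_ball_zero_iff, norm_inv]
      exact inv_lt_of_inv_lt₀ hη hz)
    have hu0 : u ≠ 0 := by
      rintro rfl
      rw [hk0] at huz
      exact inv_ne_zero (norm_pos_iff.1 hz0) huz.symm
    have hu' : ‖u‖ < min δ δ₀ := by simpa using hu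
    have hm := hmem u (by simpa using hu'.trans_le (min_le_right _ _)) hu0
    rw [hkX u hu0] at huz
    have hzu : z = X u := (inv_injective huz).symm
    rw [hzu]
    exact ⟨H.mem u hu0 hm.1.2, by
      rw [H.right_inv u hu0 hm.1.2]; exact hu'.trans_le (min_le_left _ _)⟩

/-- Properness: the annulus `δ ≤ ‖u‖ ≤ a` has compact image inside `Ω`, which misses `x`, while
smaller `u` are sent outside the ball of radius `‖x‖ + 1`. Hence `‖φ‖ > a` close to `x`. -/
theorem tendsto_norm_frontier (H : IsPuncturedDiscMap Ω φ X) {x : ℂ} (hx : x ∈ frontier Ω) :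
    Tendsto (fun z => ‖φ z‖) (𝓝[Ω] x) (𝓝 1) := by
  rw [tendsto_order]
  refine ⟨fun a ha => ?_, fun a ha => ?_⟩
  · have hinf := (tendsto_norm_atTop_iff_cobounded.2 H.tendsto_cobounded).eventually_gt_atTop
      (‖x‖ + 1)
    obtain ⟨δ, hδ, hball⟩ := Metric.mem_nhdsWithin_iff.1 hinf
    set A := {u : ℂ | δ ≤ ‖u‖ ∧ ‖u‖ ≤ a} with hA
    have hAc : IsCompact A := by
      refine (isCompact_closedBall (0 : ℂ) a).of_isClosed_subset ?_ fun u hu => by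
        simpa using hu.2
      exact (isClosed_le continuous_const continuous_norm).inter
        (isClosed_le continuous_norm continuous_const)
    have hAm : ∀ u ∈ A, u ≠ 0 ∧ ‖u‖ < 1 := fun u hu =>
      ⟨norm_pos_iff.1 (hδ.trans_le hu.1), hu.2.trans_lt ha⟩
    have hXA : IsCompact (X '' A) := hAc.image_of_continuousOn fun u hu =>
      (H.differentiableAt_inv (hAm u hu).1 (hAm u hu).2).continuousAt.continuousWithinAt
    have hxA : x ∉ X '' A := by
      rintro ⟨u, hu, rfl⟩
      rw [H.isOpen.frontier_eq] at hx
      exact hx.2 (H.mem u (hAm u hu).1 (hAm u hu).2)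
    filter_upwards [self_mem_nhdsWithin,
      nhdsWithin_le_nhds (hXA.isClosed.isOpen_compl.mem_nhds hxA),
      nhdsWithin_le_nhds (Metric.ball_mem_nhds x one_pos)] with z hz hzA hzb
    have hzn : ‖z‖ < ‖x‖ + 1 := by
      have h1 := norm_le_norm_add_norm_sub x z
      have h2 : ‖x - z‖ < 1 := by rw [← dist_eq_norm, dist_comm]; exact hzb
      linarith
    by_contra h
    push Not at h
    refine hzA ⟨φ z, ⟨?_, h⟩, H.left_inv z hz⟩
    by_contra h2
    push Not at h2
    have : ‖x‖ + 1 < ‖X (φ z)‖ := hball ⟨by simpa using h2, H.ne_zero z hz⟩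
    rw [H.left_inv z hz] at this
    linarith
  · filter_upwards [self_mem_nhdsWithin] with z hz
    exact (H.norm_lt z hz).trans ha

end IsPuncturedDiscMap

/-! ### Extension of the conformal map across the boundary -/

/-- `F` is a holomorphic extension of `φ` to the open set `U`, which sends the boundary of `Ω` to the
unit circle and the part of `U` off the closure of `Ω` injectively to the exterior of the disc. -/
structure IsBoundaryExtension (Ω : Set ℂ) (φ : ℂ → ℂ) (U : Set ℂ) (F : ℂ → ℂ) : Prop where
  isOpen : IsOpen U
  analytic : AnalyticOnNhd ℂ F U
  eq_inside : ∀ z ∈ U, z ∈ Ω → F z = φ z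
  norm_frontier : ∀ z ∈ U, z ∈ frontier Ω → ‖F z‖ = 1
  norm_outside : ∀ z ∈ U, z ∉ closure Ω → 1 < ‖F z‖
  injOn_outside : InjOn F (U \ closure Ω)

namespace IsPuncturedDiscMap

variable {Ω : Set ℂ} {φ X : ℂ → ℂ}

/-- Reflect `φ ∘ e` for a one-sided chart `e` and return by the inverse chart. Below the axis the
reflection is `1 / conj (φ (e (conj s)))`, which is injective and of modulus greater than one. -/
theorem exists_boundaryExtension (H : IsPuncturedDiscMap Ω φ X) {x : ℂ} (hx : x ∈ frontier Ω) :
    ∃ U F, x ∈ U ∧ IsBoundaryExtension Ω φ U F := by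
  obtain ⟨ε, hε, e, he, hi, h0, hup, hre, hlo⟩ :=
    exists_oneSided_chart H.isOpen H.curve H.closure_ne hx
  have heo : ∀ s ∈ Metric.ball (0 : ℂ) ε, ContinuousAt e s := fun s hs => (he s hs).continuousAt
  obtain ⟨δ, hδ, hδε, F, hF, hF1, hF2, hF3⟩ := exists_reflection_extension (g := φ ∘ e) hε
    (by
      rintro s ⟨hs, hs'⟩
      exact ((H.diff.differentiableAt (H.isOpen.mem_nhds (hup s hs hs'))).comp s
        (he s hs).differentiableAt).differentiableWithinAt)
    (by
      intro t ht
      have htm : (t : ℂ) ∈ Metric.ball (0 : ℂ) ε := by simpa using ht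
      refine (H.tendsto_norm_frontier (hre t htm (by simp))).comp ?_
      refine tendsto_nhdsWithin_iff.2 ⟨(heo t htm).tendsto.mono_left nhdsWithin_le_nhds, ?_⟩
      filter_upwards [self_mem_nhdsWithin,
        nhdsWithin_le_nhds (Metric.isOpen_ball.mem_nhds htm)] with s hs hs'
      exact hup s hs' hs)
  have hsub := Metric.ball_subset_ball (x := (0 : ℂ)) hδε
  have hopen : IsOpen (e '' Metric.ball 0 δ) :=
    Set.InjOn.isOpen_image_of_analyticOnNhd he hi Metric.isOpen_ball hsub Metric.isOpen_ball
  set l := Function.invFunOn e (Metric.ball 0 ε)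
  have hl : ∀ s ∈ Metric.ball (0 : ℂ) ε, l (e s) = s := fun s hs => hi.leftInvOn_invFunOn hs
  have hΩs : ∀ s ∈ Metric.ball (0 : ℂ) δ, e s ∈ Ω → 0 < s.im := by
    intro s hs hsΩ
    rcases lt_trichotomy s.im 0 with h | h | h
    · exact absurd (subset_closure hsΩ) (hlo s (hsub hs) h)
    · have := hre s (hsub hs) h
      rw [H.isOpen.frontier_eq] at this
      exact absurd hsΩ this.2
    · exact h
  have hos : ∀ s ∈ Metric.ball (0 : ℂ) δ, e s ∉ closure Ω → s.im < 0 := by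
    intro s hs hsΩ
    rcases lt_trichotomy s.im 0 with h | h | h
    · exact h
    · exact absurd (frontier_subset_closure (hre s (hsub hs) h)) hsΩ
    · exact absurd (subset_closure (hup s (hsub hs) h)) hsΩ
  have hconj : ∀ s ∈ Metric.ball (0 : ℂ) δ, s.im < 0 →
      starRingEnd ℂ s ∈ Metric.ball (0 : ℂ) ε ∧ e (starRingEnd ℂ s) ∈ Ω := by
    intro s hs hs0
    have hm : starRingEnd ℂ s ∈ Metric.ball (0 : ℂ) ε := hsub (by simpa using hs)
    exact ⟨hm, hup _ hm (by simpa using hs0)⟩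
  refine ⟨e '' Metric.ball 0 δ, F ∘ l, ⟨0, Metric.mem_ball_self hδ, h0⟩, hopen, ?_, ?_, ?_, ?_, ?_⟩
  · refine DifferentiableOn.analyticOnNhd ?_ hopen
    rintro _ ⟨s, hs, rfl⟩
    have h1 := Set.InjOn.differentiableAt_leftInverse he hi Metric.isOpen_ball hl (hsub hs)
    have h2 : DifferentiableAt ℂ F (l (e s)) := by
      rw [hl s (hsub hs)]; exact hF.differentiableAt (Metric.isOpen_ball.mem_nhds hs)
    exact (h2.comp _ h1).differentiableWithinAt
  · rintro _ ⟨s, hs, rfl⟩ hsΩ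
    rw [Function.comp_apply, hl s (hsub hs), hF1 s hs (hΩs s hs hsΩ)]
    rfl
  · rintro _ ⟨s, hs, rfl⟩ hsΩ
    rw [Function.comp_apply, hl s (hsub hs)]
    refine hF3 s hs ?_
    rcases lt_trichotomy s.im 0 with h | h | h
    · exact absurd (frontier_subset_closure hsΩ) (hlo s (hsub hs) h)
    · exact h
    · rw [H.isOpen.frontier_eq] at hsΩ
      exact absurd (hup s (hsub hs) h) hsΩ.2
  · rintro _ ⟨s, hs, rfl⟩ hsΩ
    have hs0 := hos s hs hsΩ
    have hc := (hconj s hs hs0).2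
    rw [Function.comp_apply, hl s (hsub hs), hF2 s hs hs0, norm_inv, RCLike.norm_conj]
    exact (one_lt_inv₀ (norm_pos_iff.2 (H.ne_zero _ hc))).2 (H.norm_lt _ hc)
  · rintro _ ⟨⟨s, hs, rfl⟩, hs1⟩ _ ⟨⟨t, ht, rfl⟩, ht1⟩ hst
    have hs0 := hos s hs hs1
    have ht0 := hos t ht ht1
    obtain ⟨hc, hc'⟩ := hconj s hs hs0
    obtain ⟨hd, hd'⟩ := hconj t ht ht0
    rw [Function.comp_apply, Function.comp_apply, hl s (hsub hs), hl t (hsub ht), hF2 s hs hs0,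
      hF2 t ht ht0] at hst
    have h1 := H.injOn hc' hd' ((starRingEnd ℂ).injective (inv_injective hst))
    rw [(starRingEnd ℂ).injective (hi hc hd h1)]

/-- Boundary extensions separate boundary points. -/
theorem boundaryExtension_separates (H : IsPuncturedDiscMap Ω φ X) {a b : ℂ} {U V : Set ℂ}
    {F G : ℂ → ℂ} (hF : IsBoundaryExtension Ω φ U F) (hG : IsBoundaryExtension Ω φ V G)
    (haU : a ∈ U) (hbV : b ∈ V) (ha : a ∈ frontier Ω) (hb : b ∈ frontier Ω) (hab : F a = G b) :
    a = b := by
  by_contra hne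
  obtain ⟨N, M, hN, hM, haN, hbM, hd⟩ := t2_separation hne
  -- An extension is open at a boundary point, since its modulus is `1` there and smaller at nearby
  -- points of `Ω`. If `F a = G b`, some `w` in the open disc is then taken near both `a` and `b`,
  -- necessarily inside `Ω`, against injectivity of `φ`.
  have key : ∀ {c : ℂ} {W : Set ℂ} {E : ℂ → ℂ}, IsBoundaryExtension Ω φ W E → c ∈ W →
      c ∈ frontier Ω → 𝓝 (E c) ≤ map E (𝓝 c) := by
    intro c W E hE hcW hc
    refine (hE.analytic c hcW).eventually_constant_or_nhds_le_map_nhds.resolve_left fun h => ?_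
    obtain ⟨z, hz, hzΩ⟩ := mem_closure_iff_nhds.1 hc.1 _
      (inter_mem h (hE.isOpen.mem_nhds hcW))
    have h1 : E z = E c := hz.1
    have h2 := H.norm_lt z hzΩ
    rw [← hE.eq_inside z hz.2 hzΩ, h1, hE.norm_frontier c hcW hc] at h2
    exact lt_irrefl _ h2
  have h1 := key hF haU ha (image_mem_map (inter_mem (hF.isOpen.mem_nhds haU) (hN.mem_nhds haN)))
  have h2 := key hG hbV hb (image_mem_map (inter_mem (hG.isOpen.mem_nhds hbV) (hM.mem_nhds hbM)))
  rw [← hab] at h2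
  have hn1 := hF.norm_frontier a haU ha
  have hcl : F a ∈ closure (Metric.ball (0 : ℂ) 1) := by
    rw [closure_ball _ one_ne_zero]; simp [hn1]
  obtain ⟨w, ⟨⟨z, hz, hzw⟩, ⟨z', hz', hzw'⟩⟩, hw⟩ := mem_closure_iff_nhds.1 hcl _ (inter_mem h1 h2)
  have hw1 : ‖w‖ < 1 := by simpa using hw
  have hin : ∀ {W : Set ℂ} {E : ℂ → ℂ}, IsBoundaryExtension Ω φ W E → ∀ y ∈ W, E y = w → y ∈ Ω := by
    intro W E hE y hy hyw
    by_contra hyΩ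
    by_cases hyc : y ∈ closure Ω
    · have := hE.norm_frontier y hy (by rw [H.isOpen.frontier_eq]; exact ⟨hyc, hyΩ⟩)
      rw [hyw] at this; linarith
    · have := hE.norm_outside y hy hyc
      rw [hyw] at this; linarith
  have hzΩ := hin hF z hz.1 hzw
  have hzΩ' := hin hG z' hz'.1 hzw'
  have heq : z = z' := H.injOn hzΩ hzΩ' (by
    rw [← hF.eq_inside z hz.1 hzΩ, ← hG.eq_inside z' hz'.1 hzΩ', hzw, hzw'])
  exact disjoint_left.1 hd hz.2 (heq ▸ hz'.2)

/-- The modulus, compared with `1`, tells apart `Ω`, its frontier and the exterior, and injectivity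
is known on each piece. -/
theorem boundaryExtension_injOn (H : IsPuncturedDiscMap Ω φ X) {U : Set ℂ} {F : ℂ → ℂ}
    (hF : IsBoundaryExtension Ω φ U F) : InjOn F U := by
  have tri : ∀ z ∈ U, (z ∈ Ω ∧ ‖F z‖ < 1) ∨ (z ∈ frontier Ω ∧ ‖F z‖ = 1) ∨
      (z ∉ closure Ω ∧ 1 < ‖F z‖) := by
    intro z hz
    by_cases h1 : z ∈ Ω
    · left; exact ⟨h1, by rw [hF.eq_inside z hz h1]; exact H.norm_lt z h1⟩
    · right
      by_cases h2 : z ∈ closure Ω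
      · left
        have h3 : z ∈ frontier Ω := by rw [H.isOpen.frontier_eq]; exact ⟨h2, h1⟩
        exact ⟨h3, hF.norm_frontier z hz h3⟩
      · right; exact ⟨h2, hF.norm_outside z hz h2⟩
  intro a ha b hb hab
  rcases tri a ha with ⟨h1, h2⟩ | ⟨h1, h2⟩ | ⟨h1, h2⟩ <;>
  rcases tri b hb with ⟨h3, h4⟩ | ⟨h3, h4⟩ | ⟨h3, h4⟩ <;> rw [hab] at h2 <;> try linarith
  · exact H.injOn h1 h3 (by rw [← hF.eq_inside a ha h1, ← hF.eq_inside b hb h3, hab])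
  · exact H.boundaryExtension_separates hF hF ha hb h1 h3 hab
  · exact hF.injOn_outside ⟨ha, h1⟩ ⟨hb, h3⟩ hab

theorem boundaryExtension_tendsto {U : Set ℂ} {F : ℂ → ℂ}
    (hF : IsBoundaryExtension Ω φ U F) {a : ℂ} (ha : a ∈ U) :
    Tendsto φ (𝓝[Ω] a) (𝓝 (F a)) := by
  refine ((hF.analytic a ha).continuousAt.tendsto.mono_left nhdsWithin_le_nhds).congr' ?_
  filter_upwards [self_mem_nhdsWithin, nhdsWithin_le_nhds (hF.isOpen.mem_nhds ha)] with z hz hz'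
  exact hF.eq_inside z hz' hz

theorem extendFrom_eq {U : Set ℂ} {F : ℂ → ℂ}
    (hF : IsBoundaryExtension Ω φ U F) {a : ℂ} (ha : a ∈ U) (haΩ : a ∈ frontier Ω) :
    extendFrom Ω φ a = F a :=
  _root_.extendFrom_eq haΩ.1 (boundaryExtension_tendsto hF ha)

theorem extendFrom_of_mem (H : IsPuncturedDiscMap Ω φ X) {a : ℂ} (ha : a ∈ Ω) :
    extendFrom Ω φ a = φ a :=
  _root_.extendFrom_eq (subset_closure ha)
    ((H.diff.differentiableAt (H.isOpen.mem_nhds ha)).continuousAt.tendsto.mono_left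
      nhdsWithin_le_nhds)

theorem tendsto_extendFrom (H : IsPuncturedDiscMap Ω φ X) {a : ℂ} (ha : a ∈ closure Ω) :
    Tendsto φ (𝓝[Ω] a) (𝓝 (extendFrom Ω φ a)) := by
  by_cases haΩ : a ∈ Ω
  · rw [H.extendFrom_of_mem haΩ]
    exact (H.diff.differentiableAt (H.isOpen.mem_nhds haΩ)).continuousAt.tendsto.mono_left
      nhdsWithin_le_nhds
  · have haf : a ∈ frontier Ω := by rw [H.isOpen.frontier_eq]; exact ⟨ha, haΩ⟩
    obtain ⟨U, F, haU, hF⟩ := H.exists_boundaryExtension haf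
    rw [extendFrom_eq hF haU haf]
    exact boundaryExtension_tendsto hF haU

theorem norm_extendFrom (H : IsPuncturedDiscMap Ω φ X) {a : ℂ} (ha : a ∈ frontier Ω) :
    ‖extendFrom Ω φ a‖ = 1 := by
  obtain ⟨U, F, haU, hF⟩ := H.exists_boundaryExtension ha
  rw [extendFrom_eq hF haU ha]
  exact hF.norm_frontier a haU ha

theorem extendFrom_injOn (H : IsPuncturedDiscMap Ω φ X) :
    InjOn (extendFrom Ω φ) (frontier Ω) := by
  intro a ha b hb hab
  obtain ⟨U, F, haU, hF⟩ := H.exists_boundaryExtension ha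
  obtain ⟨V, G, hbV, hG⟩ := H.exists_boundaryExtension hb
  rw [extendFrom_eq hF haU ha, extendFrom_eq hG hbV hb] at hab
  exact H.boundaryExtension_separates hF hG haU hbV ha hb hab

theorem extendFrom_surjOn (H : IsPuncturedDiscMap Ω φ X) {w : ℂ} (hw : ‖w‖ = 1) :
    ∃ x ∈ frontier Ω, extendFrom Ω φ x = w := by
  obtain ⟨-, -, -, hbig⟩ := H.simple_pole
  obtain ⟨M, hM⟩ := hbig (1 / 2) (by norm_num)
  have hcl : w ∈ closure (Metric.ball (0 : ℂ) 1) := by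
    rw [closure_ball _ one_ne_zero]; simp [hw]
  have hne : (𝓝[Metric.ball (0 : ℂ) 1] w).NeBot := mem_closure_iff_nhdsWithin_neBot.1 hcl
  have hev : ∀ᶠ u in 𝓝[Metric.ball (0 : ℂ) 1] w, 1 / 2 < ‖u‖ ∧ ‖u‖ < 1 := by
    filter_upwards [self_mem_nhdsWithin,
      nhdsWithin_le_nhds ((continuous_norm.tendsto w).eventually_const_lt
        (show (1 / 2 : ℝ) < ‖w‖ by rw [hw]; norm_num))] with u hu hu'
    exact ⟨hu', by simpa using hu⟩
  have hev' : ∀ᶠ u in 𝓝[Metric.ball (0 : ℂ) 1] w, X u ∈ Ω ∧ φ (X u) = u := by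
    filter_upwards [hev] with u hu
    have h0 : u ≠ 0 := norm_pos_iff.1 (by linarith [hu.1])
    exact ⟨H.mem u h0 hu.2, H.right_inv u h0 hu.2⟩
  have hbd : ∀ᶠ u in 𝓝[Metric.ball (0 : ℂ) 1] w, X u ∈ Metric.closedBall (0 : ℂ) M := by
    filter_upwards [hev, hev'] with u hu hu'
    rw [mem_closedBall_zero_iff]
    by_contra h
    push Not at h
    have := (hM _ h).2
    rw [hu'.2] at this
    linarith [hu.1]
  obtain ⟨x, -, hx⟩ := (isCompact_closedBall (0 : ℂ) M) (f := map X (𝓝[Metric.ball (0 : ℂ) 1] w))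
    (by rw [le_principal_iff]; exact hbd)
  -- A filter finer than `u → w` along which `X u` tends to its cluster point `x`; along it `φ (X u)
  -- = u` forces the boundary value at `x` to be `w`.
  set L := comap X (𝓝 x) ⊓ 𝓝[Metric.ball (0 : ℂ) 1] w with hL
  have hLne : L.NeBot := by
    have h1 : (𝓝 x ⊓ map X (𝓝[Metric.ball (0 : ℂ) 1] w)).NeBot := hx
    rw [← Filter.push_pull'] at h1
    exact map_neBot_iff X |>.1 h1
  have hXL : Tendsto X L (𝓝 x) := tendsto_comap.mono_left inf_le_left
  have hLle : L ≤ 𝓝[Metric.ball (0 : ℂ) 1] w := inf_le_right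
  have hXΩ : Tendsto X L (𝓝[Ω] x) :=
    tendsto_nhdsWithin_iff.2 ⟨hXL, (hev'.filter_mono hLle).mono fun _ h => h.1⟩
  have hxc : x ∈ closure Ω := mem_closure_of_tendsto hXL
    ((hev'.filter_mono hLle).mono fun _ h => h.1)
  have h1 := (H.tendsto_extendFrom hxc).comp hXΩ
  have h2 : Tendsto (φ ∘ X) L (𝓝 w) := by
    refine Tendsto.congr' ?_ (tendsto_id.mono_left (hLle.trans nhdsWithin_le_nhds))
    filter_upwards [hev'.filter_mono hLle] with u hu using hu.2.symm
  have h3 := tendsto_nhds_unique h1 h2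
  refine ⟨x, ?_, h3⟩
  rw [H.isOpen.frontier_eq]
  refine ⟨hxc, fun hxΩ => ?_⟩
  rw [H.extendFrom_of_mem hxΩ] at h3
  have := H.norm_lt x hxΩ
  rw [h3] at this
  linarith

/-- The inverse map extends holomorphically to a neighbourhood of each point of the circle. -/
theorem exists_local_inverse (H : IsPuncturedDiscMap Ω φ X) {w : ℂ} (hw : ‖w‖ = 1) :
    ∃ δ > 0, ∃ f : ℂ → ℂ, AnalyticOnNhd ℂ f (Metric.ball w δ) ∧ ∀ u ∈ Metric.ball w δ,
      (‖u‖ < 1 → f u = X u) ∧ (‖u‖ = 1 → f u ∈ frontier Ω ∧ extendFrom Ω φ (f u) = u) ∧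
      (1 < ‖u‖ → f u ∉ closure Ω) ∧ deriv f u ≠ 0 := by
  obtain ⟨x, hx, hxw⟩ := H.extendFrom_surjOn hw
  obtain ⟨U, F, hxU, hF⟩ := H.exists_boundaryExtension hx
  rw [extendFrom_eq hF hxU hx] at hxw
  have hinj := H.boundaryExtension_injOn hF
  have hop := Set.InjOn.isOpen_image_of_analyticOnNhd hF.analytic hinj hF.isOpen Subset.rfl
    hF.isOpen
  obtain ⟨δ, hδ, hball⟩ := Metric.mem_nhds_iff.1 (hop.mem_nhds ⟨x, hxU, hxw⟩)
  set f := Function.invFunOn F U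
  have hf : ∀ z ∈ U, f (F z) = z := fun z hz => hinj.leftInvOn_invFunOn hz
  have hfd : ∀ z ∈ U, DifferentiableAt ℂ f (F z) := fun z hz =>
    Set.InjOn.differentiableAt_leftInverse hF.analytic hinj hF.isOpen hf hz
  refine ⟨δ, hδ, f, DifferentiableOn.analyticOnNhd ?_ Metric.isOpen_ball, ?_⟩
  · intro u hu
    obtain ⟨z, hz, rfl⟩ := hball hu
    exact (hfd z hz).differentiableWithinAt
  · intro u hu
    obtain ⟨z, hz, rfl⟩ := hball hu
    rw [hf z hz]
    refine ⟨fun h => ?_, fun h => ?_, fun h => ?_, ?_⟩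
    · by_cases hzΩ : z ∈ Ω
      · rw [hF.eq_inside z hz hzΩ, H.left_inv z hzΩ]
      · exfalso
        by_cases hzc : z ∈ closure Ω
        · have := hF.norm_frontier z hz (by rw [H.isOpen.frontier_eq]; exact ⟨hzc, hzΩ⟩)
          linarith
        · have := hF.norm_outside z hz hzc
          linarith
    · have hzf : z ∈ frontier Ω := by
        rw [H.isOpen.frontier_eq]
        constructor
        · by_contra hzc
          have := hF.norm_outside z hz hzc
          linarith
        · intro hzΩ
          have := H.norm_lt z hzΩ
          rw [← hF.eq_inside z hz hzΩ] at this
          linarith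
      exact ⟨hzf, extendFrom_eq hF hz hzf⟩
    · intro hzc
      by_cases hzΩ : z ∈ Ω
      · have := H.norm_lt z hzΩ
        rw [← hF.eq_inside z hz hzΩ] at this
        linarith
      · have := hF.norm_frontier z hz (by rw [H.isOpen.frontier_eq]; exact ⟨hzc, hzΩ⟩)
        linarith
    · intro h0
      have h1 := (hfd z hz).hasDerivAt.comp z (hF.analytic z hz).differentiableAt.hasDerivAt
      have h2 : HasDerivAt (f ∘ F) 1 z := (hasDerivAt_id z).congr_of_eventuallyEq
        (by filter_upwards [hF.isOpen.mem_nhds hz] with v hv using hf v hv)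
      have := h1.unique h2
      rw [h0] at this
      simp at this

end IsPuncturedDiscMap

/-! ### Continuation of the inverse map beyond the circle -/

/-- The inverse map, written `u ↦ h u / u`, continued holomorphically beyond the unit circle. -/
structure IsContinuedInverse (Ω : Set ℂ) (φ h : ℂ → ℂ) (ρ : ℝ) : Prop where
  one_lt : 1 < ρ
  diff : DifferentiableOn ℂ h (Metric.ball 0 ρ)
  h_zero : h 0 ≠ 0
  inside : ∀ u, u ≠ 0 → ‖u‖ < 1 → h u / u ∈ Ω ∧ φ (h u / u) = u
  circle : ∀ u, ‖u‖ = 1 → h u / u ∈ frontier Ω ∧ extendFrom Ω φ (h u / u) = u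
  outside : ∀ u, 1 < ‖u‖ → ‖u‖ < ρ → h u / u ∉ closure Ω
  deriv_ne : ∀ u, u ≠ 0 → ‖u‖ ≤ 1 → u * deriv h u - h u ≠ 0

namespace IsPuncturedDiscMap

variable {Ω : Set ℂ} {φ X : ℂ → ℂ}

/-- A Lebesgue number makes the radius `δ` of the local inverses uniform, and the value at `u`
outside the disc is taken from the one centred at `u / ‖u‖`. Neighbouring choices agree: their discs
meet in a convex set that reaches into the unit disc, where both equal `X`. -/
theorem exists_continuation (H : IsPuncturedDiscMap Ω φ X) :
    ∃ ρ, 1 < ρ ∧ ∃ Y : ℂ → ℂ, (∀ u, ‖u‖ < 1 → Y u = X u) ∧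
      (∀ u, 1 ≤ ‖u‖ → ‖u‖ < ρ → DifferentiableAt ℂ Y u ∧ deriv Y u ≠ 0) ∧
      (∀ u, ‖u‖ = 1 → Y u ∈ frontier Ω ∧ extendFrom Ω φ (Y u) = u) ∧
      (∀ u, 1 < ‖u‖ → ‖u‖ < ρ → Y u ∉ closure Ω) := by
  classical
  have hloc := fun w : Metric.sphere (0 : ℂ) 1 =>
    H.exists_local_inverse (w := w) (by simp)
  choose d hd g hg hgp using hloc
  obtain ⟨δ, hδ, hleb⟩ := lebesgue_number_lemma_of_metric (isCompact_sphere (0 : ℂ) 1)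
    (c := fun w : Metric.sphere (0 : ℂ) 1 => Metric.ball (w : ℂ) (d w))
    (fun _ => Metric.isOpen_ball)
    (fun w hw => mem_iUnion.2 ⟨⟨w, hw⟩, Metric.mem_ball_self (hd _)⟩)
  have hunif : ∀ w : ℂ, ∃ f : ℂ → ℂ, ‖w‖ = 1 → AnalyticOnNhd ℂ f (Metric.ball w δ) ∧
      ∀ u ∈ Metric.ball w δ, (‖u‖ < 1 → f u = X u) ∧
      (‖u‖ = 1 → f u ∈ frontier Ω ∧ extendFrom Ω φ (f u) = u) ∧
      (1 < ‖u‖ → f u ∉ closure Ω) ∧ deriv f u ≠ 0 := by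
    intro w
    by_cases hw : ‖w‖ = 1
    · obtain ⟨i, hi⟩ := hleb w (by simpa using hw)
      exact ⟨g i, fun _ => ⟨(hg i).mono hi, fun u hu => hgp i u (hi hu)⟩⟩
    · exact ⟨X, fun h => absurd h hw⟩
  choose f hf using hunif
  set Y : ℂ → ℂ := fun u => if ‖u‖ < 1 then X u else f (u / ‖u‖) u with hY
  have hproj : ∀ u : ℂ, 1 ≤ ‖u‖ → ‖u / (‖u‖ : ℂ)‖ = 1 := by
    intro u hu
    rw [norm_div, Complex.norm_real, norm_norm, div_self (by linarith)]
  have hmem : ∀ u : ℂ, 1 ≤ ‖u‖ → ‖u‖ < 1 + δ → u ∈ Metric.ball (u / (‖u‖ : ℂ)) δ := by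
    intro u hu hu'
    have h0 : (‖u‖ : ℂ) ≠ 0 := by exact_mod_cast (by linarith : ‖u‖ ≠ 0)
    have e : u - u / (‖u‖ : ℂ) = ((‖u‖ - 1 : ℝ) : ℂ) * (u / (‖u‖ : ℂ)) := by
      push_cast; field_simp
    rw [Metric.mem_ball, dist_eq_norm, e, norm_mul, hproj u hu, mul_one, Complex.norm_real,
      Real.norm_eq_abs, abs_of_nonneg (by linarith)]
    linarith
  have hcompat : ∀ w w' u : ℂ, ‖w‖ = 1 → ‖w'‖ = 1 → w ∈ Metric.ball w' δ →
      u ∈ Metric.ball w δ → u ∈ Metric.ball w' δ → f w u = f w' u := by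
    intro w w' u hw hw' hww' hu hu'
    have hopen : IsOpen (Metric.ball w δ ∩ Metric.ball w' δ) :=
      Metric.isOpen_ball.inter Metric.isOpen_ball
    have hcl : w ∈ closure (Metric.ball (0 : ℂ) 1) := by
      rw [closure_ball _ one_ne_zero]; simp [hw]
    obtain ⟨v, hv, hv1⟩ := mem_closure_iff_nhds.1 hcl _
      (hopen.mem_nhds ⟨Metric.mem_ball_self hδ, hww'⟩)
    refine AnalyticOnNhd.eqOn_of_preconnected_of_eventuallyEq
      ((hf w hw).1.mono inter_subset_left) ((hf w' hw').1.mono inter_subset_right)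
      ((convex_ball _ _).inter (convex_ball _ _)).isPreconnected hv ?_ ⟨hu, hu'⟩
    filter_upwards [hopen.mem_nhds hv, Metric.isOpen_ball.mem_nhds hv1] with z hz hz1
    have hz1' : ‖z‖ < 1 := by simpa using hz1
    rw [((hf w hw).2 z hz.1).1 hz1', ((hf w' hw').2 z hz.2).1 hz1']
  have hYf : ∀ u : ℂ, 1 ≤ ‖u‖ → Y u = f (u / ‖u‖) u := fun u hu => by
    simp [hY, not_lt.2 hu]
  have hev : ∀ u : ℂ, 1 ≤ ‖u‖ → ‖u‖ < 1 + δ → Y =ᶠ[𝓝 u] f (u / ‖u‖) := by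
    intro u hu hu'
    have hw := hproj u hu
    have h0 : (‖u‖ : ℂ) ≠ 0 := by exact_mod_cast (by linarith : ‖u‖ ≠ 0)
    have hcont : ContinuousAt (fun v : ℂ => v / (‖v‖ : ℂ)) u :=
      continuousAt_id.div (by fun_prop) h0
    have h1 : ∀ᶠ v in 𝓝 u, v / (‖v‖ : ℂ) ∈ Metric.ball (u / (‖u‖ : ℂ)) δ :=
      hcont.preimage_mem_nhds (Metric.ball_mem_nhds _ hδ)
    have h2 : ∀ᶠ v in 𝓝 u, ‖v‖ < 1 + δ := (continuous_norm.tendsto u).eventually_lt_const hu'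
    filter_upwards [h1, h2, Metric.isOpen_ball.mem_nhds (hmem u hu hu')] with v hv1 hv2 hv3
    by_cases hv : ‖v‖ < 1
    · rw [((hf _ hw).2 v hv3).1 hv]
      simp [hY, hv]
    · push Not at hv
      rw [hYf v hv]
      exact hcompat _ _ v (hproj v hv) hw hv1 (hmem v hv hv2) hv3
  refine ⟨1 + δ, by linarith, Y, fun u hu => by simp [hY, hu], fun u hu hu' => ?_, fun u hu => ?_,
    fun u hu hu' => ?_⟩
  · have hw := hproj u hu
    have hm := hmem u hu hu'
    refine ⟨((hf _ hw).1 u hm).differentiableAt.congr_of_eventuallyEq (hev u hu hu'), ?_⟩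
    rw [(hev u hu hu').deriv_eq]
    exact ((hf _ hw).2 u hm).2.2.2
  · have hw := hproj u hu.ge
    rw [hYf u hu.ge]
    exact ((hf _ hw).2 u (hmem u hu.ge (by linarith))).2.1 hu
  · have hw := hproj u hu.le
    rw [hYf u hu.le]
    exact ((hf _ hw).2 u (hmem u hu.le hu')).2.2.1 hu

/-- Multiplication by `u` removes the simple pole. The nonvanishing condition holds because `u *
deriv h u - h u = u² * deriv Y u` for `h u = u * Y u`. -/
theorem exists_continuedInverse (H : IsPuncturedDiscMap Ω φ X) :
    ∃ ρ h, IsContinuedInverse Ω φ h ρ := by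
  obtain ⟨c, hc, hdiff, -⟩ := H.simple_pole
  obtain ⟨ρ, hρ, Y, hYX, hYd, hYc, hYo⟩ := H.exists_continuation
  set h := Function.update (fun u => u * Y u) 0 c with hh
  have hhu : ∀ u, u ≠ 0 → h u = u * Y u := fun u hu => Function.update_of_ne hu _ _
  have hdiv : ∀ u, u ≠ 0 → h u / u = Y u := fun u hu => by rw [hhu u hu]; field_simp
  have hY' : ∀ u, u ≠ 0 → ‖u‖ < ρ → DifferentiableAt ℂ Y u ∧ (‖u‖ ≤ 1 → deriv Y u ≠ 0) := by
    intro u h0 hu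
    by_cases h1 : ‖u‖ < 1
    · have he : Y =ᶠ[𝓝 u] X := by
        filter_upwards [(isOpen_lt continuous_norm continuous_const).mem_nhds h1] with v hv
          using hYX v hv
      refine ⟨(H.differentiableAt_inv h0 h1).congr_of_eventuallyEq he, fun _ => ?_⟩
      rw [he.deriv_eq]
      exact H.deriv_inv_ne_zero h0 h1
    · push Not at h1
      exact ⟨(hYd u h1 hu).1, fun _ => (hYd u h1 hu).2⟩
  have heq : ∀ u, u ≠ 0 → h =ᶠ[𝓝 u] fun u => u * Y u := fun u hu => by
    filter_upwards [isOpen_ne.mem_nhds hu] with v hv using hhu v hv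
  refine ⟨ρ, h, hρ, fun u hu => ?_, by simpa [hh] using hc, fun u h0 h1 => ?_, fun u h1 => ?_,
    fun u h1 h2 => ?_, fun u h0 h1 => ?_⟩
  · by_cases h0 : u = 0
    · rw [h0]
      refine (hdiff.congr_of_eventuallyEq ?_).differentiableWithinAt
      filter_upwards [Metric.ball_mem_nhds (0 : ℂ) one_pos] with v hv
      by_cases hv0 : v = 0
      · simp [hh, hv0]
      · rw [hhu v hv0, Function.update_of_ne hv0, hYX v (by simpa using hv)]
    · exact ((differentiableAt_id.mul (hY' u h0 (by simpa using hu)).1).congr_of_eventuallyEq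
        (heq u h0)).differentiableWithinAt
  · rw [hdiv u h0, hYX u h1]
    exact ⟨H.mem u h0 h1, H.right_inv u h0 h1⟩
  · have h0 : u ≠ 0 := norm_ne_zero_iff.1 (by rw [h1]; exact one_ne_zero)
    rw [hdiv u h0]
    exact hYc u h1
  · have h0 : u ≠ 0 := norm_pos_iff.1 (by linarith)
    rw [hdiv u h0]
    exact hYo u h1 h2
  · have hY := hY' u h0 (by linarith)
    have hd : deriv h u = Y u + u * deriv Y u := by
      rw [(heq u h0).deriv_eq, deriv_fun_mul differentiableAt_fun_id hY.1]
      simp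
    rw [hd, hhu u h0]
    have : u * (Y u + u * deriv Y u) - u * Y u = u * u * deriv Y u := by ring
    rw [this]
    exact mul_ne_zero (mul_ne_zero h0 h0) (hY.2 h1)

end IsPuncturedDiscMap

/-! ### Faber polynomials -/

theorem Polynomial.exists_derivative_eq (Q : Polynomial ℂ) :
    ∃ P : Polynomial ℂ, P.derivative = Q := by
  induction Q using Polynomial.induction_on' with
  | add p q hp hq =>
    obtain ⟨P, rfl⟩ := hp
    obtain ⟨R, rfl⟩ := hq
    exact ⟨P + R, by simp⟩
  | monomial n a =>
    refine ⟨Polynomial.monomial (n + 1) (a / (n + 1)), ?_⟩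
    have : (n : ℂ) + 1 ≠ 0 := by exact_mod_cast n.succ_ne_zero
    rw [Polynomial.derivative_monomial]
    simp [div_mul_cancel₀ _ this]

/-- Removal of the polar part of `g u / u ^ k` by a polynomial in `h u / u`. -/
theorem exists_polynomial_part {h : ℂ → ℂ} {ρ : ℝ} (hρ : 0 < ρ)
    (hh : DifferentiableOn ℂ h (Metric.ball 0 ρ)) (h0 : h 0 ≠ 0) (k : ℕ) {g : ℂ → ℂ}
    (hg : DifferentiableOn ℂ g (Metric.ball 0 ρ)) :
    ∃ F : Polynomial ℂ, F.natDegree ≤ k ∧ ∃ q : ℂ → ℂ, DifferentiableOn ℂ q (Metric.ball 0 ρ) ∧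
      ∀ u, u ≠ 0 → g u / u ^ k - F.eval (h u / u) = u * q u := by
  have hm := Metric.ball_mem_nhds (0 : ℂ) hρ
  induction k generalizing g with
  | zero =>
    refine ⟨Polynomial.C (g 0), by simp, dslope g 0,
      (Complex.differentiableOn_dslope hm).2 hg, fun u hu => ?_⟩
    rw [dslope_of_ne _ hu, slope_def_field]
    simp only [pow_zero, div_one, Polynomial.eval_C, sub_zero]
    field_simp
  | succ k ih =>
    -- Subtracting `a * (h u / u) ^ (k + 1)` cancels the leading polar coefficient and lowers the
    -- pole order by one. The base case also removes the constant term, which is why the remainder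
    -- is divisible by `u`.
    set a := g 0 / h 0 ^ (k + 1) with ha
    set g₂ : ℂ → ℂ := fun u => g u - a * h u ^ (k + 1) with hg₂
    have hg₂d : DifferentiableOn ℂ g₂ (Metric.ball 0 ρ) := hg.sub ((hh.pow (k + 1)).const_mul a)
    have hg₂0 : g₂ 0 = 0 := by
      simp only [hg₂, ha]; field_simp; ring
    obtain ⟨F, hF, q, hq, hFq⟩ := ih ((Complex.differentiableOn_dslope hm).2 hg₂d)
    refine ⟨F + Polynomial.C a * Polynomial.X ^ (k + 1), ?_, q, hq, fun u hu => ?_⟩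
    · refine (Polynomial.natDegree_add_le _ _).trans (max_le (by omega) ?_)
      exact Polynomial.natDegree_C_mul_X_pow_le a (k + 1)
    · rw [← hFq u hu, dslope_of_ne _ hu, slope_def_field, hg₂0]
      simp only [hg₂, Polynomial.eval_add, Polynomial.eval_mul, Polynomial.eval_C,
        Polynomial.eval_pow, Polynomial.eval_X, sub_zero, div_pow, pow_succ]
      generalize Polynomial.eval (h u / u) F = y
      field_simp
      ring

namespace IsContinuedInverse

variable {Ω : Set ℂ} {φ h : ℂ → ℂ} {ρ : ℝ}

theorem mem_closure (H : IsContinuedInverse Ω φ h ρ) {v : ℂ} (hv0 : v ≠ 0) (hv : ‖v‖ ≤ 1) :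
    h v / v ∈ closure Ω := by
  rcases hv.lt_or_eq with h1 | h1
  · exact subset_closure (H.inside v hv0 h1).1
  · exact frontier_subset_closure (H.circle v h1).1

/-- The three regions of `u` have images in `Ω`, on its frontier and off its closure. As `v` stays
in the closed disc, injectivity among exterior points is never required. -/
theorem eq_of_div_eq (H : IsContinuedInverse Ω φ h ρ) (hΩ : IsOpen Ω) {u v : ℂ} (hu0 : u ≠ 0)
    (hu : ‖u‖ < ρ) (hv0 : v ≠ 0) (hv : ‖v‖ ≤ 1) (huv : h u / u = h v / v) : u = v := by
  have hfr : ∀ z ∈ frontier Ω, z ∉ Ω := fun z hz => by rw [hΩ.frontier_eq] at hz; exact hz.2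
  rcases lt_trichotomy ‖u‖ 1 with h1 | h1 | h1
  · have hui := H.inside u hu0 h1
    rcases hv.lt_or_eq with h2 | h2
    · rw [← hui.2, huv, (H.inside v hv0 h2).2]
    · exact absurd (huv ▸ hui.1) (hfr _ (H.circle v h2).1)
  · have hui := H.circle u h1
    rcases hv.lt_or_eq with h2 | h2
    · exact absurd (huv ▸ (H.inside v hv0 h2).1) (hfr _ hui.1)
    · rw [← hui.2, huv, (H.circle v h2).2]
  · exact absurd (huv ▸ H.mem_closure hv0 hv) (H.outside u h1 hu)

/-- The Cauchy kernel of the curve, in the coordinate of the disc. -/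
theorem exists_kernel (H : IsContinuedInverse Ω φ h ρ) (hΩ : IsOpen Ω) {v : ℂ}
    (hv0 : v ≠ 0) (hv : ‖v‖ ≤ 1) :
    ∃ κ : ℂ → ℂ, DifferentiableOn ℂ κ (Metric.ball 0 ρ) ∧ κ v = v ∧ κ 0 = v ∧
      ∀ u, ‖u‖ < ρ → u ≠ 0 → u ≠ v →
        (u * deriv h u - h u) / u ^ 2 / (h u / u - h v / v) = κ u / (u * (u - v)) := by
  have hvm : v ∈ Metric.ball (0 : ℂ) ρ := by simpa using hv.trans_lt H.one_lt
  have hnhds := Metric.isOpen_ball.mem_nhds hvm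
  have hρ : 0 < ρ := one_pos.trans H.one_lt
  -- With `X u = h u / u`, `D u = u * v * (X u - X v)` vanishes on the disc only at `v`, and simply.
  -- So `E = D / (u - v)` has no zeros and `κ = v * (u * deriv h u - h u) / E` is holomorphic.
  set D : ℂ → ℂ := fun u => v * h u - u * h v with hD
  have hDd : DifferentiableOn ℂ D (Metric.ball 0 ρ) :=
    (H.diff.const_mul v).sub (differentiableOn_id.mul_const _)
  have hD0 : D v = 0 := by simp [hD]
  set E := dslope D v with hE
  have hEd : DifferentiableOn ℂ E (Metric.ball 0 ρ) :=
    (Complex.differentiableOn_dslope hnhds).2 hDd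
  have hEv : E v = v * deriv h v - h v := by
    rw [hE, dslope_same]
    have h1 := ((H.diff.differentiableAt hnhds).hasDerivAt.const_mul v).sub
      ((hasDerivAt_id v).mul_const (h v))
    rw [one_mul] at h1
    exact h1.deriv
  have hEu : ∀ u, u ≠ v → E u = D u / (u - v) := fun u hu => by
    rw [hE, dslope_of_ne _ hu, slope_def_field, hD0, sub_zero]
  have hDu : ∀ u, ‖u‖ < ρ → u ≠ v → D u ≠ 0 := by
    intro u hu huv h0
    by_cases hu0 : u = 0
    · rw [hu0] at h0
      simp only [hD, zero_mul, sub_zero, mul_eq_zero] at h0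
      exact h0.elim hv0 H.h_zero
    · apply huv
      refine H.eq_of_div_eq hΩ hu0 hu hv0 hv ?_
      rw [div_eq_div_iff hu0 hv0]
      simp only [hD] at h0
      linear_combination h0
  have hE0 : ∀ u ∈ Metric.ball (0 : ℂ) ρ, E u ≠ 0 := by
    intro u hu
    by_cases huv : u = v
    · rw [huv, hEv]; exact H.deriv_ne v hv0 hv
    · rw [hEu u huv]
      exact div_ne_zero (hDu u (by simpa using hu) huv) (sub_ne_zero.2 huv)
  refine ⟨fun u => v * (u * deriv h u - h u) / E u, ?_, ?_, ?_, ?_⟩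
  · exact (((differentiableOn_id.mul (H.diff.deriv Metric.isOpen_ball)).sub H.diff).const_mul
      v).div hEd hE0
  · have := H.deriv_ne v hv0 hv
    simp only [hEv]
    field_simp
  · have := H.h_zero
    simp only [hEu 0 hv0.symm, hD]
    field_simp
    ring
  · intro u hu hu0 huv
    have h1 := hDu u hu huv
    have h2 : u - v ≠ 0 := sub_ne_zero.2 huv
    have h3 : h u / u - h v / v = D u / (u * v) := by
      simp only [hD]; field_simp
    simp only [h3, hEu u huv]
    field_simp

/-- Integral representation of the error of the polynomial part. -/
theorem integral_representation (H : IsContinuedInverse Ω φ h ρ) (hΩ : IsOpen Ω) {v : ℂ}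
    (hv0 : v ≠ 0) (hv : ‖v‖ ≤ 1) {r : ℝ} (hr : 1 < r) (hrρ : r < ρ) {k : ℕ} {F : Polynomial ℂ}
    {q : ℂ → ℂ} (hq : DifferentiableOn ℂ q (Metric.ball 0 ρ))
    (hFq : ∀ u, u ≠ 0 → 1 / u ^ k - F.eval (h u / u) = u * q u) :
    (∮ u in C(0, r), 1 / u ^ k * ((u * deriv h u - h u) / u ^ 2 / (h u / u - h v / v))) =
      2 * Real.pi * Complex.I * (1 / v ^ k - F.eval (h v / v)) := by
  obtain ⟨κ, hκd, hκv, hκ0, hκ⟩ := H.exists_kernel hΩ hv0 hv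
  have hr0 : 0 < r := by linarith
  have hcb : Metric.closedBall (0 : ℂ) r ⊆ Metric.ball 0 ρ := Metric.closedBall_subset_ball hrρ
  have hsp : ∀ u ∈ Metric.sphere (0 : ℂ) r, ‖u‖ < ρ ∧ u ≠ 0 ∧ u ≠ v ∧ u ∈ Metric.ball (0 : ℂ) ρ := by
    intro u hu
    have hn : ‖u‖ = r := by simpa using hu
    refine ⟨by linarith, norm_pos_iff.1 (by linarith), ?_, by simpa [hn] using hrρ⟩
    rintro rfl
    linarith
  have hvr : v ∈ Metric.ball (0 : ℂ) r := by simpa using hv.trans_lt hr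
  have h0r : (0 : ℂ) ∈ Metric.ball (0 : ℂ) r := by simpa using hr0
  have cauchy : ∀ {f : ℂ → ℂ} {w : ℂ}, DifferentiableOn ℂ f (Metric.ball 0 ρ) →
      w ∈ Metric.ball (0 : ℂ) r →
      (∮ u in C(0, r), f u / (u - w)) = 2 * Real.pi * Complex.I * f w := fun hf hw =>
    Complex.circleIntegral_div_sub_of_differentiable_on_off_countable countable_empty hw
      (hf.continuousOn.mono hcb)
      fun z hz => hf.differentiableAt (Metric.isOpen_ball.mem_nhds
        (Metric.ball_subset_ball hrρ.le hz.1))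
  have hint : ∀ {f : ℂ → ℂ}, ContinuousOn f (Metric.sphere 0 r) → CircleIntegrable f 0 r :=
    fun hf => hf.circleIntegrable hr0.le
  have hκc : ContinuousOn κ (Metric.sphere 0 r) :=
    hκd.continuousOn.mono fun u hu => (hsp u hu).2.2.2
  have hqc : ContinuousOn q (Metric.sphere 0 r) :=
    hq.continuousOn.mono fun u hu => (hsp u hu).2.2.2
  have hhc : ContinuousOn h (Metric.sphere 0 r) :=
    H.diff.continuousOn.mono fun u hu => (hsp u hu).2.2.2
  have hh'c : ContinuousOn (deriv h) (Metric.sphere 0 r) :=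
    (H.diff.deriv Metric.isOpen_ball).continuousOn.mono fun u hu => (hsp u hu).2.2.2
  have hXc : ContinuousOn (fun u => h u / u) (Metric.sphere 0 r) :=
    hhc.div continuousOn_id fun u hu => (hsp u hu).2.1
  have hX' : ∀ u ∈ Metric.sphere (0 : ℂ) r,
      HasDerivAt (fun u => h u / u) ((u * deriv h u - h u) / u ^ 2) u := by
    intro u hu
    obtain ⟨-, hu0, -, hum⟩ := hsp u hu
    have := (H.diff.differentiableAt (Metric.isOpen_ball.mem_nhds hum)).hasDerivAt.div
      (hasDerivAt_id u) hu0
    refine this.congr_deriv ?_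
    simp only [id]; ring
  have hX'c : ContinuousOn (fun u => (u * deriv h u - h u) / u ^ 2) (Metric.sphere 0 r) :=
    ((continuousOn_id.mul hh'c).sub hhc).div (continuousOn_id.pow 2)
      fun u hu => pow_ne_zero 2 (hsp u hu).2.1
  have hkerc : ContinuousOn (fun u => κ u / (u * (u - v))) (Metric.sphere 0 r) :=
    hκc.div (continuousOn_id.mul (continuousOn_id.sub continuousOn_const))
      fun u hu => mul_ne_zero (hsp u hu).2.1 (sub_ne_zero.2 (hsp u hu).2.2.1)
  -- The residues at `v` and at the pole `0` of `X` are `1` and `-1`.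
  have hker : (∮ u in C(0, r), κ u / (u * (u - v))) = 0 := by
    have h1 : (∮ u in C(0, r), κ u / (u * (u - v))) =
        ∮ u in C(0, r), v⁻¹ * (κ u / (u - v)) - v⁻¹ * (κ u / (u - 0)) := by
      refine circleIntegral.integral_congr hr0.le fun u hu => ?_
      obtain ⟨-, hu0, huv, -⟩ := hsp u hu
      have h2 : u - v ≠ 0 := sub_ne_zero.2 huv
      simp only [sub_zero]
      field_simp
      ring
    rw [h1, circleIntegral.integral_sub, circleIntegral.integral_const_mul,
      circleIntegral.integral_const_mul, cauchy hκd hvr, cauchy hκd h0r, hκv, hκ0, sub_self]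
    · refine hint (continuousOn_const.mul (hκc.div (continuousOn_id.sub continuousOn_const)
        fun u hu => sub_ne_zero.2 (hsp u hu).2.2.1))
    · refine hint (continuousOn_const.mul (hκc.div (continuousOn_id.sub continuousOn_const)
        fun u hu => sub_ne_zero.2 (hsp u hu).2.1))
  -- Writing `F (X u) = (X u - X v) * Q (X u) + F (X v)`, the first term contributes `Q (X u) * X'
  -- u`, an exact derivative, and the second a multiple of the vanishing kernel integral. Only the
  -- remainder `u * q u` counts, and Cauchy's formula gives it as `q v * κ v = v * q v`.
  obtain ⟨Q, hQ⟩ := Polynomial.X_sub_C_dvd_sub_C_eval (a := h v / v) (p := F)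
  obtain ⟨P, hP⟩ := Q.exists_derivative_eq
  have hexact : (∮ u in C(0, r), Q.eval (h u / u) * ((u * deriv h u - h u) / u ^ 2)) = 0 := by
    refine circleIntegral.integral_eq_zero_of_hasDerivWithinAt
      (f := fun u => P.eval (h u / u)) hr0.le fun u hu => ?_
    have := HasDerivAt.comp (h := fun u => h u / u) u (P.hasDerivAt (h u / u)) (hX' u hu)
    rw [hP] at this
    exact this.hasDerivWithinAt
  have hQc : ContinuousOn (fun u => Q.eval (h u / u)) (Metric.sphere 0 r) :=
    Q.continuous.comp_continuousOn hXc
  have hmain : (∮ u in C(0, r), 1 / u ^ k *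
      ((u * deriv h u - h u) / u ^ 2 / (h u / u - h v / v))) =
      ∮ u in C(0, r), q u * κ u / (u - v) +
        (Q.eval (h u / u) * ((u * deriv h u - h u) / u ^ 2) +
          F.eval (h v / v) * (κ u / (u * (u - v)))) := by
    refine circleIntegral.integral_congr hr0.le fun u hu => ?_
    obtain ⟨hu, hu0, huv, -⟩ := hsp u hu
    have h1 : 1 / u ^ k = u * q u + F.eval (h u / u) := by rw [← hFq u hu0]; ring
    have h2 : F.eval (h u / u) = (h u / u - h v / v) * Q.eval (h u / u) + F.eval (h v / v) := by
      have := congrArg (Polynomial.eval (h u / u)) hQ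
      simp only [Polynomial.eval_sub, Polynomial.eval_C, Polynomial.eval_mul,
        Polynomial.eval_X] at this
      linear_combination this
    have h3 : h u / u - h v / v ≠ 0 := sub_ne_zero.2 fun h =>
      huv (H.eq_of_div_eq hΩ hu0 hu hv0 hv h)
    have h4 : u - v ≠ 0 := sub_ne_zero.2 huv
    have hk := hκ u hu hu0 huv
    set A := h u / u - h v / v
    set B := (u * deriv h u - h u) / u ^ 2
    have h5 : B = A * (κ u / (u * (u - v))) := by rw [← hk]; field_simp
    rw [h1, h2, hk, h5]
    field_simp
  have hqκ : DifferentiableOn ℂ (fun u => q u * κ u) (Metric.ball 0 ρ) := hq.mul hκd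
  rw [hmain, circleIntegral.integral_add, circleIntegral.integral_add,
    circleIntegral.integral_const_mul, hker, hexact, cauchy hqκ hvr, hκv, hFq v hv0]
  · ring
  · exact hint (hQc.mul hX'c)
  · exact hint (continuousOn_const.mul hkerc)
  · exact hint ((hqc.mul hκc).div (continuousOn_id.sub continuousOn_const)
      fun u hu => sub_ne_zero.2 (hsp u hu).2.2.1)
  · exact hint ((hQc.mul hX'c).add (continuousOn_const.mul hkerc))

/-- **Faber polynomials** of a domain with analytic boundary: they approximate the powers of the
exterior map geometrically fast, uniformly up to the boundary. -/
theorem exists_faber (H : IsContinuedInverse Ω φ h ρ) (hΩ : IsOpen Ω) :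
    ∃ C r : ℝ, 0 ≤ C ∧ 1 < r ∧ ∀ k : ℕ, ∃ F : Polynomial ℂ, F.natDegree ≤ k ∧
      ∀ v, v ≠ 0 → ‖v‖ ≤ 1 → ‖1 / v ^ k - F.eval (h v / v)‖ ≤ C * (r⁻¹) ^ k := by
  obtain ⟨r, hr, hrρ⟩ := exists_between H.one_lt
  have hr0 : 0 < r := by linarith
  have hsp : ∀ u ∈ Metric.sphere (0 : ℂ) r, ‖u‖ = r ∧ u ≠ 0 ∧ u ∈ Metric.ball (0 : ℂ) ρ := by
    intro u hu
    have hn : ‖u‖ = r := by simpa using hu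
    exact ⟨hn, norm_pos_iff.1 (by linarith), by simpa [hn] using hrρ⟩
  have hhc : ContinuousOn h (Metric.sphere 0 r) :=
    H.diff.continuousOn.mono fun u hu => (hsp u hu).2.2
  have hh'c : ContinuousOn (deriv h) (Metric.sphere 0 r) :=
    (H.diff.deriv Metric.isOpen_ball).continuousOn.mono fun u hu => (hsp u hu).2.2
  have hXc : ContinuousOn (fun u => h u / u) (Metric.sphere 0 r) :=
    hhc.div continuousOn_id fun u hu => (hsp u hu).2.1
  have hX'c : ContinuousOn (fun u => (u * deriv h u - h u) / u ^ 2) (Metric.sphere 0 r) :=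
    ((continuousOn_id.mul hh'c).sub hhc).div (continuousOn_id.pow 2)
      fun u hu => pow_ne_zero 2 (hsp u hu).2.1
  obtain ⟨M, hM⟩ := (isCompact_sphere (0 : ℂ) r).exists_bound_of_continuousOn hX'c
  have hM0 : 0 ≤ max M 0 := le_max_right _ _
  -- The circle of radius `r > 1` is mapped off `closure Ω`, hence at positive distance `d` from it.
  -- This bounds the kernel uniformly in `v`, and `1 / u ^ k` supplies the decay.
  obtain ⟨d, hd, hdist⟩ := Metric.exists_pos_forall_lt_edist
    ((isCompact_sphere (0 : ℂ) r).image_of_continuousOn hXc) (isClosed_closure (s := Ω))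
    (by
      rw [disjoint_left]
      rintro _ ⟨u, hu, rfl⟩ hc
      exact H.outside u (by rw [(hsp u hu).1]; exact hr) (by rw [(hsp u hu).1]; exact hrρ) hc)
  have hd' : (0 : ℝ) < d := hd
  refine ⟨r * (max M 0 / d), r, by positivity, hr, fun k => ?_⟩
  obtain ⟨F, hF, q, hq, hFq⟩ := exists_polynomial_part (one_pos.trans H.one_lt) H.diff H.h_zero k
    (differentiableOn_const (1 : ℂ))
  refine ⟨F, hF, fun v hv0 hv => ?_⟩
  have hrep := H.integral_representation hΩ hv0 hv hr hrρ hq hFq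
  have hbound := circleIntegral.norm_two_pi_i_inv_smul_integral_le_of_norm_le_const
    (f := fun u => 1 / u ^ k * ((u * deriv h u - h u) / u ^ 2 / (h u / u - h v / v)))
    (c := 0) (R := r) (C := (r⁻¹) ^ k * (max M 0 / d)) hr0.le (by
      intro u hu
      have hn := (hsp u hu).1
      rw [norm_mul, norm_div, norm_one, norm_pow, hn, norm_div, one_div, inv_pow]
      gcongr
      · exact (hM u hu).trans (le_max_left _ _)
      · have h1 := hdist _ ⟨u, hu, rfl⟩ _ (H.mem_closure hv0 hv)
        rw [edist_nndist] at h1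
        have h2 : d < nndist (h u / u) (h v / v) := by exact_mod_cast h1
        rw [← dist_eq_norm]
        exact (show (d : ℝ) < dist (h u / u) (h v / v) from h2).le)
  rw [hrep, smul_eq_mul, inv_mul_cancel_left₀ Complex.two_pi_I_ne_zero] at hbound
  linarith [hbound]

end IsContinuedInverse

/-! ### Elementary properties of Christoffel functions -/

section Christoffel

variable {n : ℕ} {ν : Measure ℂ} {z : ℂ}

theorem christoffel_le {p : Polynomial ℂ} (hp : p.natDegree ≤ n) (hz : p.eval z = 1) :
    christoffel n ν z ≤ ∫ w, ‖p.eval w‖ ^ 2 ∂ν :=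
  csInf_le ⟨0, by rintro _ ⟨p, -, -, rfl⟩; positivity⟩ ⟨p, hp, hz, rfl⟩

theorem le_christoffel {a : ℝ}
    (h : ∀ p : Polynomial ℂ, p.natDegree ≤ n → p.eval z = 1 → a ≤ ∫ w, ‖p.eval w‖ ^ 2 ∂ν) :
    a ≤ christoffel n ν z :=
  le_csInf ⟨_, 1, by simp, by simp, rfl⟩ (by rintro _ ⟨p, hp, hz, rfl⟩; exact h p hp hz)

theorem christoffel_nonneg : 0 ≤ christoffel n ν z :=
  le_christoffel fun _ _ _ => by positivity

/-- Homogeneous form of the extremal property, suited to polynomials whose value at the point is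
only asymptotically normalised. -/
theorem christoffel_mul_le {p : Polynomial ℂ} (hp : p.natDegree ≤ n) :
    christoffel n ν z * ‖p.eval z‖ ^ 2 ≤ ∫ w, ‖p.eval w‖ ^ 2 ∂ν := by
  by_cases h0 : p.eval z = 0
  · rw [h0, norm_zero, zero_pow two_ne_zero, mul_zero]
    positivity
  · have h1 := christoffel_le (n := n) (ν := ν) (z := z) (p := Polynomial.C (p.eval z)⁻¹ * p)
      ((Polynomial.natDegree_C_mul_le _ _).trans hp) (by simp [h0])
    have h2 : ∀ w, ‖(Polynomial.C (p.eval z)⁻¹ * p).eval w‖ ^ 2 =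
        (‖p.eval z‖ ^ 2)⁻¹ * ‖p.eval w‖ ^ 2 := fun w => by
      rw [Polynomial.eval_mul, Polynomial.eval_C, norm_mul, norm_inv, mul_pow, inv_pow]
    simp_rw [h2, integral_const_mul] at h1
    have h3 : 0 < ‖p.eval z‖ ^ 2 := by positivity
    rwa [inv_mul_eq_div, le_div_iff₀ h3] at h1

theorem christoffel_antitone : Antitone fun n => christoffel n ν z := fun _ _ hmn =>
  le_christoffel fun _ hp hz => christoffel_le (hp.trans hmn) hz

theorem tendsto_christoffel_iInf :
    Tendsto (fun n => christoffel n ν z) atTop (𝓝 (⨅ n, christoffel n ν z)) :=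
  tendsto_atTop_ciInf christoffel_antitone
    ⟨0, by rintro _ ⟨n, rfl⟩; exact christoffel_nonneg⟩

theorem iInf_christoffel_le (n : ℕ) : ⨅ m, christoffel m ν z ≤ christoffel n ν z :=
  ciInf_le ⟨0, by rintro _ ⟨n, rfl⟩; exact christoffel_nonneg⟩ n

end Christoffel

/-! ### Approximation tools -/

/-- Uniform convergence almost everywhere gives convergence of the `L²` integrals. -/
theorem tendsto_integral_norm_sq_of_uniform {μ : Measure ℂ} [IsFiniteMeasure μ]
    {f : ℕ → ℂ → ℂ} {g : ℂ → ℂ} {B : ℝ} {η : ℕ → ℝ}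
    (hf : ∀ᶠ n in atTop, AEStronglyMeasurable (f n) μ) (hη : Tendsto η atTop (𝓝 0))
    (hfg : ∀ᶠ n in atTop, ∀ᵐ x ∂μ, ‖f n x - g x‖ ≤ η n) (hg : ∀ᵐ x ∂μ, ‖g x‖ ≤ B) :
    Tendsto (fun n => ∫ x, ‖f n x‖ ^ 2 ∂μ) atTop (𝓝 (∫ x, ‖g x‖ ^ 2 ∂μ)) := by
  obtain ⟨N, hN⟩ := eventually_atTop.1 hfg
  have hall : ∀ᵐ x ∂μ, ∀ n, N ≤ n → ‖f n x - g x‖ ≤ η n := by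
    rw [ae_all_iff]
    intro n
    by_cases h : N ≤ n
    · filter_upwards [hN n h] with x hx _ using hx
    · exact Eventually.of_forall fun x hx => absurd hx h
  refine tendsto_integral_filter_of_dominated_convergence (fun _ => (B + 1) ^ 2) ?_ ?_
    (integrable_const _) ?_
  · filter_upwards [hf] with n hn using (hn.norm.pow 2)
  · filter_upwards [hfg, hη.eventually_le_const one_pos] with n hn hn1
    filter_upwards [hn, hg] with x hx hgx
    have h1 : ‖f n x‖ ≤ B + 1 := by
      have := norm_le_norm_add_norm_sub (g x) (f n x)
      rw [norm_sub_rev] at this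
      linarith
    rw [norm_pow, norm_norm]
    gcongr
  · filter_upwards [hall] with x hx
    have h1 : Tendsto (fun n => f n x - g x) atTop (𝓝 0) := by
      refine squeeze_zero_norm' ?_ hη
      filter_upwards [eventually_ge_atTop N] with n hn using hx n hn
    have h2 : Tendsto (fun n => f n x) atTop (𝓝 (g x)) := by
      simpa using h1.add_const (g x)
    exact (h2.norm.pow 2)

/-- Functions holomorphic on a neighbourhood of the closed unit disc are uniform limits of
polynomials. -/
theorem exists_polynomial_approx {g : ℂ → ℂ} {ρ : ℝ} (hρ : 1 < ρ)
    (hg : DifferentiableOn ℂ g (Metric.ball 0 ρ)) :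
    ∃ T : ℕ → Polynomial ℂ, (∀ n, (T n).natDegree ≤ n) ∧
      ∃ η : ℕ → ℝ, Tendsto η atTop (𝓝 0) ∧ ∀ n u, ‖u‖ ≤ 1 → ‖(T n).eval u - g u‖ ≤ η n := by
  obtain ⟨r, hr, hrρ⟩ := exists_between hρ
  obtain ⟨r', hr', hrr'⟩ := exists_between hr
  lift r to NNReal using by linarith
  lift r' to NNReal using by linarith
  have hr0 : 0 < r := by
    have : (0 : ℝ) < r := by linarith
    exact_mod_cast this
  have hps := (hg.mono (Metric.closedBall_subset_ball hrρ)).hasFPowerSeriesOnBall hr0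
  set P := cauchyPowerSeries g 0 r
  obtain ⟨a, ha, C, hC, hbound⟩ := hps.uniform_geometric_approx (r' := r')
    (by exact_mod_cast hrr')
  refine ⟨fun n => ∑ k ∈ Finset.range n, Polynomial.monomial k (P.coeff k), fun n => ?_,
    fun n => C * a ^ n, ?_, fun n u hu => ?_⟩
  · refine Polynomial.natDegree_sum_le_of_forall_le _ _ fun k hk => ?_
    exact (Polynomial.natDegree_monomial_le _).trans (Finset.mem_range.1 hk).le
  · simpa using (tendsto_pow_atTop_nhds_zero_of_lt_one ha.1.le ha.2).const_mul C
  · have h1 := hbound u (by simpa using hu.trans_lt hr') n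
    rw [zero_add, norm_sub_rev] at h1
    have h2 : (∑ k ∈ Finset.range n, Polynomial.monomial k (P.coeff k)).eval u =
        P.partialSum n u := by
      rw [FormalMultilinearSeries.partialSum, Polynomial.eval_finsetSum]
      refine Finset.sum_congr rfl fun k _ => ?_
      rw [Polynomial.eval_monomial, FormalMultilinearSeries.apply_eq_pow_smul_coeff, smul_eq_mul,
        mul_comm]
    rwa [h2]

/-- Conjugating coefficients exchanges the evaluation point `1 / conj (Φ z) = conj (φ z)` with `φ
z`, and boundary values of `Φ` with those of `φ`. -/
theorem Polynomial.eval_conj_map (p : Polynomial ℂ) (w : ℂ) :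
    (p.map (starRingEnd ℂ)).eval (starRingEnd ℂ w) = starRingEnd ℂ (p.eval w) := by
  rw [Polynomial.eval_map_apply]

/-- The holomorphic function `u ^ n * P (h u / u)`. -/
theorem exists_differentiableOn_mul_eval {h : ℂ → ℂ} {U : Set ℂ} (hh : DifferentiableOn ℂ h U)
    {n : ℕ} {P : Polynomial ℂ} (hP : P.natDegree ≤ n) :
    ∃ g : ℂ → ℂ, DifferentiableOn ℂ g U ∧ ∀ u, u ≠ 0 → g u = u ^ n * P.eval (h u / u) := by
  refine ⟨fun u => ∑ i ∈ Finset.range (n + 1), P.coeff i * (h u ^ i * u ^ (n - i)), ?_,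
    fun u hu => ?_⟩
  · exact DifferentiableOn.fun_sum fun i _ =>
      ((hh.pow i).mul (differentiableOn_id.pow _)).const_mul _
  · rw [Polynomial.eval_eq_sum_range' (Nat.lt_succ_of_le hP), Finset.mul_sum]
    refine Finset.sum_congr rfl fun i hi => ?_
    have hin : n = (n - i) + i := (Nat.sub_add_cancel (Nat.lt_succ_iff.1
      (Finset.mem_range.1 hi))).symm
    conv_rhs => rw [hin]
    rw [pow_add, div_pow]
    field_simp

/-! ### Comparison of the extremal problems on the curve and on the circle -/

namespace IsContinuedInverse

variable {Ω : Set ℂ} {φ X h : ℂ → ℂ} {ρ : ℝ}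

theorem div_eq_of_mem (HC : IsContinuedInverse Ω φ h ρ) (H : IsPuncturedDiscMap Ω φ X) {z : ℂ}
    (hz : z ∈ Ω) : h (φ z) / φ z = z := by
  have := HC.inside (φ z) (H.ne_zero z hz) (H.norm_lt z hz)
  exact H.injOn this.1 hz this.2

theorem div_eq_of_mem_frontier (HC : IsContinuedInverse Ω φ h ρ) (H : IsPuncturedDiscMap Ω φ X)
    {x : ℂ} (hx : x ∈ frontier Ω) : h (extendFrom Ω φ x) / extendFrom Ω φ x = x := by
  have := HC.circle _ (H.norm_extendFrom hx)
  exact H.extendFrom_injOn this.1 hx this.2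

variable {μ : Measure ℂ} [IsFiniteMeasure μ]

/-- Lower bound for the Christoffel functions of the curve by those of the circle; the latter are
encoded by the constant `L`. -/
theorem lower_bound (HC : IsContinuedInverse Ω φ h ρ) (H : IsPuncturedDiscMap Ω φ X)
    (hψ : AEMeasurable (extendFrom Ω φ) μ) (hμ : ∀ᵐ x ∂μ, x ∈ frontier Ω) {z : ℂ} (hz : z ∈ Ω)
    {L : ℝ}
    (hL : ∀ q : Polynomial ℂ, L * ‖q.eval (φ z)‖ ^ 2 ≤ ∫ x, ‖q.eval (extendFrom Ω φ x)‖ ^ 2 ∂μ)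
    {n : ℕ} {P : Polynomial ℂ} (hP : P.natDegree ≤ n) (hPz : P.eval z = 1) :
    L * ‖φ z‖ ^ (2 * n) ≤ ∫ x, ‖P.eval x‖ ^ 2 ∂μ := by
  obtain ⟨g, hg, hgu⟩ := exists_differentiableOn_mul_eval HC.diff hP
  obtain ⟨T, -, η, hη, hT⟩ := exists_polynomial_approx HC.one_lt hg
  have hgx : ∀ᵐ x ∂μ, ‖g (extendFrom Ω φ x)‖ = ‖P.eval x‖ := by
    filter_upwards [hμ] with x hx
    have hn := H.norm_extendFrom hx
    rw [hgu _ (norm_ne_zero_iff.1 (by rw [hn]; exact one_ne_zero)),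
      HC.div_eq_of_mem_frontier H hx, norm_mul, norm_pow, hn, one_pow, one_mul]
  have hgz : ‖g (φ z)‖ ^ 2 = ‖φ z‖ ^ (2 * n) := by
    rw [hgu _ (H.ne_zero z hz), HC.div_eq_of_mem H hz, hPz, mul_one, norm_pow, ← pow_mul, mul_comm]
  obtain ⟨B, hB⟩ := (isCompact_sphere (0 : ℂ) 1).exists_bound_of_continuousOn
    (hg.continuousOn.mono (Metric.sphere_subset_closedBall.trans
      (Metric.closedBall_subset_ball HC.one_lt)))
  have hlim := tendsto_integral_norm_sq_of_uniform (μ := μ)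
    (f := fun m x => (T m).eval (extendFrom Ω φ x)) (g := fun x => g (extendFrom Ω φ x))
    (B := B) (η := η)
    (Eventually.of_forall fun m =>
      ((T m).continuous.measurable.comp_aemeasurable hψ).aestronglyMeasurable) hη
    (Eventually.of_forall fun m => by
      filter_upwards [hμ] with x hx using hT m _ (H.norm_extendFrom hx).le)
    (by filter_upwards [hμ] with x hx using hB _ (by simpa using H.norm_extendFrom hx))
  rw [integral_congr_ae (g := fun x => ‖P.eval x‖ ^ 2)
    (by filter_upwards [hgx] with x hx; rw [hx])] at hlim
  have hlim2 : Tendsto (fun m => (T m).eval (φ z)) atTop (𝓝 (g (φ z))) := by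
    rw [tendsto_iff_norm_sub_tendsto_zero]
    exact squeeze_zero (fun _ => norm_nonneg _) (fun m => hT m _ (H.norm_lt z hz).le) hη
  have hlim3 := (hlim2.norm.pow 2).const_mul L
  rw [hgz] at hlim3
  exact le_of_tendsto_of_tendsto' hlim3 hlim fun m => hL (T m)

/-- Transplanting a polynomial from the disc to the curve by means of Faber polynomials. -/
theorem exists_transplant (HC : IsContinuedInverse Ω φ h ρ) (hΩ : IsOpen Ω) (q : Polynomial ℂ) :
    ∃ P : ℕ → Polynomial ℂ, (∀ n, q.natDegree ≤ n → (P n).natDegree ≤ n) ∧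
      ∃ η : ℕ → ℝ, Tendsto η atTop (𝓝 0) ∧ ∀ n, q.natDegree ≤ n → ∀ u, u ≠ 0 → ‖u‖ ≤ 1 →
        ‖u ^ n * (P n).eval (h u / u) - q.eval u‖ ≤ η n := by
  obtain ⟨C, r, hC, hr, hF⟩ := HC.exists_faber hΩ
  choose F hFd hFb using hF
  have hr0 : 0 < r := by linarith
  -- Since `u ^ n * u ^ (-(n - j)) = u ^ j`, the polynomial `F (n - j)` stands in for `u ^ j`; its
  -- error `C * r ^ (-(n - j))` is the source of the factor `r ^ j`.
  refine ⟨fun n => ∑ j ∈ Finset.range (q.natDegree + 1), Polynomial.C (q.coeff j) * F (n - j),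
    fun n hn => ?_,
    fun n => (∑ j ∈ Finset.range (q.natDegree + 1), ‖q.coeff j‖ * (C * r ^ j)) * (r⁻¹) ^ n,
    ?_, fun n hn u hu0 hu => ?_⟩
  · refine Polynomial.natDegree_sum_le_of_forall_le _ _ fun j _ => ?_
    exact (Polynomial.natDegree_C_mul_le _ _).trans ((hFd _).trans (Nat.sub_le _ _))
  · simpa using (tendsto_pow_atTop_nhds_zero_of_lt_one (inv_nonneg.2 hr0.le)
      (inv_lt_one_of_one_lt₀ hr)).const_mul
        (∑ j ∈ Finset.range (q.natDegree + 1), ‖q.coeff j‖ * (C * r ^ j))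
  · beta_reduce
    rw [Polynomial.eval_finsetSum, Polynomial.eval_eq_sum_range, Finset.mul_sum,
      ← Finset.sum_sub_distrib, Finset.sum_mul]
    refine norm_sum_le_of_le _ fun j hj => ?_
    have hjn : j ≤ n := (Nat.lt_succ_iff.1 (Finset.mem_range.1 hj)).trans hn
    have e : u ^ n * (Polynomial.C (q.coeff j) * F (n - j)).eval (h u / u) - q.coeff j * u ^ j =
        - (q.coeff j * (u ^ n * (1 / u ^ (n - j) - (F (n - j)).eval (h u / u)))) := by
      have h1 : u ^ n = u ^ (n - j) * u ^ j := by rw [← pow_add, Nat.sub_add_cancel hjn]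
      have h2 : u ^ (n - j) ≠ 0 := pow_ne_zero _ hu0
      rw [Polynomial.eval_mul, Polynomial.eval_C, h1]
      field_simp
      ring
    have e2 : C * r ^ j * (r⁻¹) ^ n = C * (r⁻¹) ^ (n - j) := by
      have h1 : (r⁻¹) ^ n = (r⁻¹) ^ (n - j) * (r⁻¹) ^ j := by
        rw [← pow_add, Nat.sub_add_cancel hjn]
      rw [h1, inv_pow r j]
      field_simp
    rw [e, norm_neg, norm_mul, norm_mul, norm_pow, mul_assoc, e2]
    refine mul_le_mul_of_nonneg_left ?_ (norm_nonneg _)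
    calc ‖u‖ ^ n * ‖1 / u ^ (n - j) - (F (n - j)).eval (h u / u)‖
        ≤ 1 * (C * (r⁻¹) ^ (n - j)) := by
          gcongr
          · exact pow_le_one₀ (norm_nonneg _) hu
          · exact hFb (n - j) u hu0 hu
      _ = _ := one_mul _

/-- Upper bound for the Christoffel functions of the curve by a polynomial on the circle. -/
theorem upper_bound (HC : IsContinuedInverse Ω φ h ρ) (H : IsPuncturedDiscMap Ω φ X)
    (hψ : AEMeasurable (extendFrom Ω φ) μ) (hμ : ∀ᵐ x ∂μ, x ∈ frontier Ω) {z : ℂ} (hz : z ∈ Ω)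
    {q : Polynomial ℂ} (hq : q.eval (φ z) = 1) {a : ℝ}
    (ha : ∫ x, ‖q.eval (extendFrom Ω φ x)‖ ^ 2 ∂μ < a) :
    ∀ᶠ n in atTop, (‖φ z‖⁻¹) ^ (2 * n) * christoffel n μ z < a := by
  obtain ⟨P, hPd, η, hη, hP⟩ := HC.exists_transplant H.isOpen q
  have hz0 := H.ne_zero z hz
  obtain ⟨B, hB⟩ := (isCompact_sphere (0 : ℂ) 1).exists_bound_of_continuousOn
    q.continuous.continuousOn
  have hlim := tendsto_integral_norm_sq_of_uniform (μ := μ)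
    (f := fun n x => extendFrom Ω φ x ^ n * (P n).eval x)
    (g := fun x => q.eval (extendFrom Ω φ x)) (B := B) (η := η)
    (Eventually.of_forall fun n => ((hψ.pow_const n).mul
      (P n).continuous.measurable.aemeasurable).aestronglyMeasurable) hη
    (by
      filter_upwards [eventually_ge_atTop q.natDegree] with n hn
      filter_upwards [hμ] with x hx
      have hn1 := H.norm_extendFrom hx
      have := hP n hn (extendFrom Ω φ x)
        (norm_ne_zero_iff.1 (by rw [hn1]; exact one_ne_zero)) hn1.le
      rwa [HC.div_eq_of_mem_frontier H hx] at this)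
    (by filter_upwards [hμ] with x hx using hB _ (by simpa using H.norm_extendFrom hx))
  have hint : ∀ n, ∫ x, ‖extendFrom Ω φ x ^ n * (P n).eval x‖ ^ 2 ∂μ =
      ∫ x, ‖(P n).eval x‖ ^ 2 ∂μ := fun n => integral_congr_ae (by
    filter_upwards [hμ] with x hx
    rw [norm_mul, norm_pow, H.norm_extendFrom hx, one_pow, one_mul])
  simp_rw [hint] at hlim
  have hlim2 : Tendsto (fun n => φ z ^ n * (P n).eval z) atTop (𝓝 1) := by
    rw [← hq, tendsto_iff_norm_sub_tendsto_zero]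
    refine squeeze_zero' (Eventually.of_forall fun _ => norm_nonneg _) ?_ hη
    filter_upwards [eventually_ge_atTop q.natDegree] with n hn
    have := hP n hn (φ z) hz0 (H.norm_lt z hz).le
    rwa [HC.div_eq_of_mem H hz] at this
  have hlim3 := hlim2.norm.pow 2
  rw [norm_one, one_pow] at hlim3
  -- The transplanted polynomial satisfies `φ z ^ n * P n z → 1` only in the limit, so its integral
  -- is divided by `‖φ z ^ n * P n z‖²` before comparison with the Christoffel function.
  have hlim4 := hlim.div hlim3 one_ne_zero
  rw [div_one] at hlim4
  filter_upwards [hlim4.eventually_lt_const ha, hlim3.eventually_const_lt one_pos,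
    eventually_ge_atTop q.natDegree] with n h1 h2 h3
  refine lt_of_le_of_lt ?_ h1
  rw [Pi.div_apply, le_div_iff₀ h2]
  have h4 := christoffel_mul_le (ν := μ) (z := z) (hPd n h3)
  refine le_trans (le_of_eq ?_) h4
  have h5 : ‖φ z‖ ≠ 0 := norm_ne_zero_iff.2 hz0
  rw [norm_mul, norm_pow, mul_pow, ← pow_mul, mul_comm n 2, inv_pow]
  field_simp

end IsContinuedInverse

/-! ### Conclusion -/

theorem IsExteriorConformalMap.isPuncturedDiscMap {K : Set ℂ} (hK : IsCompact K)
    (hKs : IsSimplyConnected K) (hΓ : IsAnalyticClosedCurve (frontier (unboundedComponent K)))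
    {Φ : ℂ → ℂ} (hΦ : IsExteriorConformalMap (unboundedComponent K) Φ) :
    IsPuncturedDiscMap (unboundedComponent K) (fun z => (Φ z)⁻¹)
      (Function.invFunOn (fun z => (Φ z)⁻¹) (unboundedComponent K)) := by
  obtain ⟨hd, hmaps, hinj, hsurj⟩ := hΦ
  have hn : ∀ z ∈ unboundedComponent K, 1 < ‖Φ z‖ := fun z hz => hmaps hz
  have hne : ∀ z ∈ unboundedComponent K, Φ z ≠ 0 := fun z hz =>
    norm_pos_iff.1 (one_pos.trans (hn z hz))
  have hinj' : InjOn (fun z => (Φ z)⁻¹) (unboundedComponent K) := fun a ha b hb hab =>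
    hinj ha hb (inv_injective hab)
  have hex : ∀ u : ℂ, u ≠ 0 → ‖u‖ < 1 → ∃ z ∈ unboundedComponent K, (Φ z)⁻¹ = u := by
    intro u h0 h1
    obtain ⟨z, hz, hzu⟩ := hsurj (show u⁻¹ ∈ {w : ℂ | 1 < ‖w‖} by
      rw [mem_ofPred_eq, norm_inv]
      exact (one_lt_inv₀ (norm_pos_iff.2 h0)).2 h1)
    exact ⟨z, hz, by rw [hzu, inv_inv]⟩
  exact
    { isOpen := isOpen_unboundedComponent hK.isClosed
      curve := hΓ
      closure_ne := closure_unboundedComponent_ne_univ hK.isClosed hKs hΓ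
      diff := hd.inv hne
      norm_lt := fun z hz => by rw [norm_inv]; exact inv_lt_one_of_one_lt₀ (hn z hz)
      ne_zero := fun z hz => inv_ne_zero (hne z hz)
      mem := fun u h0 h1 => Function.invFunOn_mem (hex u h0 h1)
      left_inv := fun z hz => hinj'.leftInvOn_invFunOn hz
      right_inv := fun u h0 h1 => Function.invFunOn_eq (hex u h0 h1) }

theorem corollary4p3 (K : Set ℂ) (hK : IsCompact K) (hKs : IsSimplyConnected K)
    (hΓ : IsAnalyticClosedCurve (frontier (unboundedComponent K)))
    (Φ : ℂ → ℂ) (hΦ : IsExteriorConformalMap (unboundedComponent K) Φ) :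
    ContinuousOn (extendFrom (unboundedComponent K) Φ) (closure (unboundedComponent K)) ∧
    MapsTo (extendFrom (unboundedComponent K) Φ) (frontier (unboundedComponent K))
      (Metric.sphere (0 : ℂ) 1) ∧
    ∀ (μ : Measure ℂ) [IsFiniteMeasure μ], μ (frontier (unboundedComponent K))ᶜ = 0 →
      ∀ z ∈ unboundedComponent K,
        Tendsto (fun n : ℕ => normChristoffel Φ n μ z) atTop
          (𝓝 (normChristoffelLimit Φ μ z)) ∧
        Tendsto (fun n : ℕ => christoffel n
            (boundaryPushforward (unboundedComponent K) Φ μ) (1 / starRingEnd ℂ (Φ z))) atTop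
          (𝓝 (christoffelLimit (boundaryPushforward (unboundedComponent K) Φ μ)
            (1 / starRingEnd ℂ (Φ z)))) ∧
        normChristoffelLimit Φ μ z =
          christoffelLimit (boundaryPushforward (unboundedComponent K) Φ μ)
            (1 / starRingEnd ℂ (Φ z)) := by
  have H := hΦ.isPuncturedDiscMap hK hKs hΓ
  obtain ⟨ρ, h, HC⟩ := H.exists_continuedInverse
  set Ω := unboundedComponent K
  set φ : ℂ → ℂ := fun z => (Φ z)⁻¹ with hφ
  set ψ := extendFrom Ω φ with hψdef
  have hψ0 : ∀ x ∈ closure Ω, ψ x ≠ 0 := by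
    intro x hx
    by_cases hxΩ : x ∈ Ω
    · rw [hψdef, H.extendFrom_of_mem hxΩ]; exact H.ne_zero x hxΩ
    · have := H.norm_extendFrom (a := x) (by rw [H.isOpen.frontier_eq]; exact ⟨hx, hxΩ⟩)
      exact norm_ne_zero_iff.1 (by rw [this]; exact one_ne_zero)
  have htend : ∀ x ∈ closure Ω, Tendsto Φ (𝓝[Ω] x) (𝓝 (ψ x)⁻¹) := fun x hx =>
    ((H.tendsto_extendFrom hx).inv₀ (hψ0 x hx)).congr fun z => by simp [hφ]
  have hext : ∀ x ∈ closure Ω, extendFrom Ω Φ x = (ψ x)⁻¹ := fun x hx =>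
    extendFrom_eq hx (htend x hx)
  have hcont : ContinuousOn (extendFrom Ω Φ) (closure Ω) :=
    continuousOn_extendFrom Subset.rfl fun x hx => ⟨_, htend x hx⟩
  have hcontψ : ContinuousOn ψ (closure Ω) :=
    continuousOn_extendFrom Subset.rfl fun x hx => ⟨_, H.tendsto_extendFrom hx⟩
  refine ⟨hcont, fun x hx => ?_, ?_⟩
  · rw [mem_sphere_zero_iff_norm, hext x hx.1, norm_inv, H.norm_extendFrom hx, inv_one]
  intro μ _ hμ z hz
  have hae : ∀ᵐ x ∂μ, x ∈ frontier Ω := hμ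
  -- The extensions are controlled only on `closure Ω`; as `μ` lives on the closed frontier,
  -- continuity there gives a.e. measurability.
  have hres : μ.restrict (frontier Ω) = μ := Measure.restrict_eq_self_of_ae_mem hae
  have hψm : AEMeasurable ψ μ := by
    rw [← hres]
    exact (hcontψ.mono frontier_subset_closure).aemeasurable isClosed_frontier.measurableSet
  have hΦm : AEMeasurable (extendFrom Ω Φ) μ := by
    rw [← hres]
    exact (hcont.mono frontier_subset_closure).aemeasurable isClosed_frontier.measurableSet
  set ν := boundaryPushforward Ω Φ μ with hν
  have hζ : 1 / starRingEnd ℂ (Φ z) = starRingEnd ℂ (φ z) := by simp [hφ]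
  rw [hζ]
  -- On the frontier the extension of `Φ` is `1 / ψ = conj ψ`, because `‖ψ‖ = 1`.
  have hint : ∀ p : Polynomial ℂ, ∫ w, ‖p.eval w‖ ^ 2 ∂ν =
      ∫ x, ‖(p.map (starRingEnd ℂ)).eval (ψ x)‖ ^ 2 ∂μ := by
    intro p
    have hpc : Continuous fun w => ‖p.eval w‖ ^ 2 := p.continuous.norm.pow 2
    rw [hν, boundaryPushforward, integral_map hΦm hpc.aestronglyMeasurable]
    refine integral_congr_ae ?_
    filter_upwards [hae] with x hx
    have h1 := p.eval_conj_map (starRingEnd ℂ (ψ x))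
    rw [Complex.conj_conj] at h1
    rw [h1, RCLike.norm_conj, hext x hx.1, Complex.inv_eq_conj (H.norm_extendFrom hx)]
  have hmm : ∀ q : Polynomial ℂ, (q.map (starRingEnd ℂ)).map (starRingEnd ℂ) = q := fun q => by
    rw [Polynomial.map_map]; simp
  have hL : ∀ q : Polynomial ℂ, (⨅ m, christoffel m ν (starRingEnd ℂ (φ z))) *
      ‖q.eval (φ z)‖ ^ 2 ≤ ∫ x, ‖q.eval (ψ x)‖ ^ 2 ∂μ := by
    intro q
    have h1 := christoffel_mul_le (ν := ν) (z := starRingEnd ℂ (φ z))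
      (p := q.map (starRingEnd ℂ)) le_rfl
    rw [hint, hmm, q.eval_conj_map, RCLike.norm_conj] at h1
    exact (mul_le_mul_of_nonneg_right (iInf_christoffel_le _) (by positivity)).trans h1
  set L := ⨅ m, christoffel m ν (starRingEnd ℂ (φ z)) with hLdef
  have hlimν : Tendsto (fun n => christoffel n ν (starRingEnd ℂ (φ z))) atTop (𝓝 L) :=
    tendsto_christoffel_iInf
  have hz0 : 0 < ‖φ z‖ := norm_pos_iff.2 (H.ne_zero z hz)
  have hnorm : ∀ n, normChristoffel Φ n μ z = (‖φ z‖⁻¹) ^ (2 * n) * christoffel n μ z := by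
    intro n
    rw [normChristoffel, hφ]
    simp only [norm_inv, inv_inv]
  have hlim : Tendsto (fun n => normChristoffel Φ n μ z) atTop (𝓝 L) := by
    rw [tendsto_order]
    refine ⟨fun a ha => Eventually.of_forall fun n => ha.trans_le ?_, fun a ha => ?_⟩
    · have h1 : L * ‖φ z‖ ^ (2 * n) ≤ christoffel n μ z := le_christoffel fun P hP hPz =>
        HC.lower_bound H hψm hae hz hL hP hPz
      rw [hnorm, inv_pow, inv_mul_eq_div, le_div_iff₀ (by positivity)]
      exact h1
    · obtain ⟨m, hm⟩ := exists_lt_of_ciInf_lt ha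
      obtain ⟨_, ⟨p, -, hpz, rfl⟩, hpa⟩ := exists_lt_of_csInf_lt
        (⟨_, 1, by simp, by simp, rfl⟩ : {x : ℝ | ∃ p : Polynomial ℂ, p.natDegree ≤ m ∧
          p.eval (starRingEnd ℂ (φ z)) = 1 ∧ x = ∫ w, ‖p.eval w‖ ^ 2 ∂ν}.Nonempty) hm
      rw [hint] at hpa
      have h1 := p.eval_conj_map (starRingEnd ℂ (φ z))
      rw [Complex.conj_conj, hpz, map_one] at h1
      filter_upwards [HC.upper_bound H hψm hae hz h1 hpa] with n hn
      rwa [hnorm]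
  have e1 : normChristoffelLimit Φ μ z = L := hlim.liminf_eq
  have e2 : christoffelLimit ν (starRingEnd ℂ (φ z)) = L := hlimν.limUnder_eq
  rw [e1, e2]
  exact ⟨hlim, hlimν, rfl⟩
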